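/- Let $G$ be a connected Lie group with finite center whose Lie algebra $\mathfrak g$ is a split real form of a complex simple Lie algebra. Let $\theta$ be a Cartan involution of $\mathfrak g$ with Cartan decomposition $\mathfrak g=\mathfrak k\oplus\mathfrak s$, let $\mathfrak a\subset\mathfrak s$ be a maximal abelian subalgebra, let $K=\langle\exp\mathfrak k\rangle$, and let $M=\{g\in K : \mathrm{Ad}(g)H=H \text{ for all } H\in\mathfrak a\}$ be the centralizer of $\mathfrak a$ in $K$. Let $\alpha$ be a root of $(\mathfrak g,\mathfrak a)$, with root spaces $\mathfrak g_{\pm\alpha}=\{X\in\mathfrak g : [H,X]=\pm\alpha(H)X \text{ for all } H\in\mathfrak a\}$, let $\mathfrak g(\alpha)$ be the subalgebra of $\mathfrak g$ generated by $\mathfrak g_\alpha$ and $\mathfrak g_{-\alpha}$, and let $G(\alpha)=\langle\exp\mathfrak g(\alpha)\rangle\subset G$ be the connected subgroup with Lie algebra $\mathfrak g(\alpha)$. Then $\mathfrak g(\alpha)\cong\mathfrak{sl}(2,\mathbb R)$, and the center $Z(G(\alpha))$ of $G(\alpha)$ is contained in $M$. -/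

import Mathlib

open scoped Manifold ContDiff TensorProduct

noncomputable section

/-! ### Real semisimple Lie algebras -/

section Algebra

variable {L : Type*} [LieRing L] [LieAlgebra ℝ L]

/-- A Cartan involution: an involutive automorphism `θ` such that the symmetric bilinear form
`(X, Y) ↦ -⟨X, θ Y⟩`, with `⟨·, ·⟩` the Cartan-Killing form, is positive definite. -/
structure IsCartanInvolution (θ : L ≃ₗ⁅ℝ⁆ L) : Prop where
  involutive : ∀ X : L, θ (θ X) = X
  pos_def : ∀ X : L, X ≠ 0 → 0 < -(killingForm ℝ L X (θ X))

/-- The compact part `𝔨 = {X | θ X = X}` of the decomposition `𝔤 = 𝔨 ⊕ 𝔰`. -/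
def compactPart (θ : L ≃ₗ⁅ℝ⁆ L) : Set L := {X | θ X = X}

/-- The noncompact part `𝔰 = {X | θ X = -X}` of the decomposition `𝔤 = 𝔨 ⊕ 𝔰`. -/
def noncompactPart (θ : L ≃ₗ⁅ℝ⁆ L) : Set L := {X | θ X = -X}

/-- `𝔞` is maximal among the abelian subalgebras of `𝔤` that are contained in `S`. -/
def IsMaximalAbelianIn (S : Set L) (𝔞 : LieSubalgebra ℝ L) : Prop :=
  Maximal (fun 𝔟 : LieSubalgebra ℝ L => (𝔟 : Set L) ⊆ S ∧ IsLieAbelian 𝔟) 𝔞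

variable (L) in
/-- `𝔤` is a split (normal) real form of a complex simple Lie algebra: its complexification is
simple, and in each Cartan decomposition `𝔤 = 𝔨 ⊕ 𝔰` the space `𝔰` contains a maximal abelian
subalgebra of `𝔤`. -/
structure IsSplitRealFormOfSimple : Prop where
  simple : LieAlgebra.IsSimple ℂ (ℂ ⊗[ℝ] L)
  split : ∀ θ : L ≃ₗ⁅ℝ⁆ L, IsCartanInvolution θ →
    ∃ 𝔥 : LieSubalgebra ℝ L, (𝔥 : Set L) ⊆ noncompactPart θ ∧ IsMaximalAbelianIn Set.univ 𝔥

/-- The root space `𝔤_α = {X | ∀ H ∈ 𝔞, [H, X] = α(H) X}` of a linear form `α` on `𝔞`. -/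
def rootSpaceOf (𝔞 : LieSubalgebra ℝ L) (α : Module.Dual ℝ 𝔞) : Set L :=
  {X | ∀ H : 𝔞, ⁅(H : L), X⁆ = α H • X}

/-- `α` is a root of the pair `(𝔤, 𝔞)`. -/
def IsRootOf (𝔞 : LieSubalgebra ℝ L) (α : Module.Dual ℝ 𝔞) : Prop :=
  α ≠ 0 ∧ ∃ X ∈ rootSpaceOf 𝔞 α, X ≠ 0

/-- The subalgebra `𝔤(α)` generated by the root spaces `𝔤_α` and `𝔤_{-α}`. -/
def rootSubalgebra (𝔞 : LieSubalgebra ℝ L) (α : Module.Dual ℝ 𝔞) : LieSubalgebra ℝ L :=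
  LieSubalgebra.lieSpan ℝ L (rootSpaceOf 𝔞 α ∪ rootSpaceOf 𝔞 (-α))

end Algebra

/-! ### Lie groups -/

section Group

variable {E : Type*} [NormedAddCommGroup E] [NormedSpace ℝ E]
  {G : Type*} [TopologicalSpace G] [ChartedSpace E G] [Group G]

/-- A smooth Lie group has the smoothness needed for the bracket on `GroupLieAlgebra`. -/
instance instLieGroupMinSmoothness [LieGroup 𝓘(ℝ, E) ∞ G] :
    LieGroup 𝓘(ℝ, E) (minSmoothness ℝ 3) G :=
  LieGroup.of_le (n := ∞) (by
    rw [minSmoothness_of_isRCLikeNormedField]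
    exact ENat.LEInfty.out)

/-- `g = exp X`: the integral curve through `1` of the left invariant vector field of `X`
takes the value `g` at time `1`. -/
def IsExp (X : GroupLieAlgebra 𝓘(ℝ, E) G) (g : G) : Prop :=
  ∃ γ : ℝ → G, γ 0 = 1 ∧
    IsMIntegralCurve (I := 𝓘(ℝ, E)) γ (fun x : G => mulInvariantVectorField X x) ∧ γ 1 = g

/-- The subgroup `⟨exp S⟩` of `G` generated by the exponentials of the elements of `S`.
For a subalgebra `S` it is the connected Lie subgroup with Lie algebra `S`. -/
def expSubgroup (S : Set (GroupLieAlgebra 𝓘(ℝ, E) G)) : Subgroup G :=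
  Subgroup.closure {g | ∃ X ∈ S, IsExp X g}

/-- The adjoint representation: `Ad g` is the derivative at `1` of `x ↦ g x g⁻¹`. -/
def adjointMap (g : G) (X : GroupLieAlgebra 𝓘(ℝ, E) G) : GroupLieAlgebra 𝓘(ℝ, E) G :=
  mfderiv 𝓘(ℝ, E) 𝓘(ℝ, E) (fun x : G => g * x * g⁻¹) 1 X

variable [LieGroup 𝓘(ℝ, E) ∞ G] [CompleteSpace E]

/-- The subgroup `K = ⟨exp 𝔨⟩`. -/
def compactSubgroup (θ : GroupLieAlgebra 𝓘(ℝ, E) G ≃ₗ⁅ℝ⁆ GroupLieAlgebra 𝓘(ℝ, E) G) :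
    Subgroup G :=
  expSubgroup (compactPart θ)

/-- The centralizer `M` of `𝔞` in `K`. -/
def centralizerInK (θ : GroupLieAlgebra 𝓘(ℝ, E) G ≃ₗ⁅ℝ⁆ GroupLieAlgebra 𝓘(ℝ, E) G)
    (𝔞 : LieSubalgebra ℝ (GroupLieAlgebra 𝓘(ℝ, E) G)) : Set G :=
  {g | g ∈ compactSubgroup θ ∧ ∀ H ∈ 𝔞, adjointMap g H = H}

/-- The connected subgroup `G(α) = ⟨exp 𝔤(α)⟩`. -/
def rootSubgroup (𝔞 : LieSubalgebra ℝ (GroupLieAlgebra 𝓘(ℝ, E) G)) (α : Module.Dual ℝ 𝔞) :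
    Subgroup G :=
  expSubgroup (rootSubalgebra 𝔞 α : Set (GroupLieAlgebra 𝓘(ℝ, E) G))

end Group

end

/-!
The space `𝔞` is its own centralizer in `𝔤`. For this, let `𝔥 ⊆ 𝔰` be a maximal abelian subalgebra
of `𝔤`, which exists because `𝔤` is split. Both `𝔞` and `𝔥` contain regular elements, with the same
centralizers as the whole subspaces (`IsCartanInvolution.exists_regular`), and an automorphism
commuting with `θ` brings a regular element of `𝔞` into the centralizer of one of `𝔥`: minimize
`f ↦ ⟪f X, Y⟫` over a compact group of automorphisms
(`exists_isometric_automorphism_bracket_eq_zero`). It follows that the automorphism carries `𝔞`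
onto `𝔥` (`IsSplitRealFormOfSimple.mem_of_forall_lie_eq_zero`).

Hence `[𝔤_α, 𝔤_{-α}] ⊆ 𝔞`, and the inner product `-⟨X, θ Y⟩` shows that `𝔤_α` is a line and that
`𝔤(α)` is spanned by an `sl₂`-triple `(h, e, -θ e)` with `h ∈ 𝔞` (`exists_isSl2Triple`). This gives
`𝔤(α) ≅ 𝔰𝔩(2, ℝ)`.

On the group, `Ad (exp (t X))` is the flow of the linear vector field `ad X`
(`adjointCLM_expCurve_eq`), which rests on computing the bracket of left invariant fields from the
second derivative of the multiplication (`hasDerivAt_adjointCLM_zero`). With `f = -θ e`, every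
element of `G(α)` is a product `k a n` of exponentials of multiples of `f - e`, `h` and `e`
(`exists_iwasawa`): the differential equation for the Iwasawa coordinates of a curve
`k a n exp (t X)` has global solutions, which are explicit in terms of `2 × 2` matrices. For a
central element `z = k a n` of `G(α)`, `Ad z` is trivial on `h` and `e`; the explicit formulas for
`Ad` then force `a = n = 1` (`iwasawa_eq_of_adjointCLM_eq`), so `z` is the exponential of a multiple
of `f - e`, an element of `𝔨`. Finally `Ad z` is trivial on `𝔞 = ker α ⊕ ℝ h`, because `f - e`
commutes with `ker α`.
-/

noncomputable section

/-! ### Commuting symmetric operators and exponentials of operators -/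

section LinearAlgebra

open Module.End in
/-- A linear family of commuting symmetric operators has a regular member: one whose kernel is the
common kernel of the family. -/
theorem exists_regular_of_isSymmetric {V A : Type*} [NormedAddCommGroup V] [InnerProductSpace ℝ V]
    [FiniteDimensional ℝ V] [AddCommGroup A] [Module ℝ A] (T : A →ₗ[ℝ] Module.End ℝ V)
    (hT : ∀ a, (T a).IsSymmetric) (hc : ∀ a b, Commute (T a) (T b)) :
    ∃ a, ∀ v, T a v = 0 → ∀ b, T b v = 0 := by
  classical
  let N : (A → ℝ) → Submodule ℝ V := fun χ => ⨅ a, eigenspace (T a) (χ a)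
  have hN : ∀ χ v, v ∈ N χ ↔ ∀ a, T a v = χ a • v := by
    intro χ v; simp [N, Submodule.mem_iInf]
  have htop : ⨆ χ, N χ = ⊤ :=
    LinearMap.IsSymmetric.iSup_iInf_eq_top_of_commute hT fun a b _ => hc a b
  have hfin : {χ | N χ ≠ ⊥}.Finite := WellFoundedGT.finite_ne_bot_of_iSupIndep
    (LinearMap.IsSymmetric.orthogonalFamily_iInf_eigenspaces hT).independent
  have hF : {χ | N χ ≠ ⊥ ∧ χ ≠ 0}.Finite := hfin.subset fun χ h => h.1
  have hlin : ∀ χ : {χ | N χ ≠ ⊥ ∧ χ ≠ 0}, ∃ f : Module.Dual ℝ A, ∀ a, f a = χ.1 a := by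
    rintro ⟨χ, h, -⟩
    obtain ⟨v, hv, hv0⟩ := Submodule.exists_mem_ne_zero_of_ne_bot h
    rw [hN] at hv
    refine ⟨{ toFun := χ, map_add' := fun a b => ?_, map_smul' := fun c a => ?_ }, fun _ => rfl⟩
    · refine smul_left_injective ℝ hv0 ?_
      simp only [add_smul, ← hv, map_add, LinearMap.add_apply]
    · refine smul_left_injective ℝ hv0 ?_
      simp only [RingHom.id_apply, smul_eq_mul, mul_smul, ← hv, map_smul, LinearMap.smul_apply]
  choose f hf using hlin
  have := hF.to_subtype
  -- A vector space over an infinite field is not a finite union of the kernels of the weights.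
  obtain ⟨a, ha⟩ := Module.Dual.exists_forall_ne_zero_of_forall_exists f (by
    rintro ⟨χ, h, h0⟩
    obtain ⟨b, hb⟩ := Function.ne_iff.1 h0
    exact ⟨b, by rw [hf]; exact hb⟩)
  refine ⟨a, fun v hv b => ?_⟩
  -- `T b v` is orthogonal to every joint eigenspace, and these span.
  have hspan : (⊤ : Submodule ℝ V) ≤ LinearMap.ker (innerₛₗ ℝ (T b v)) := by
    rw [← htop, iSup_le_iff]
    intro χ w hw
    have hw' := (hN χ w).1 hw
    rw [LinearMap.mem_ker, innerₛₗ_apply_apply, hT b, hw', inner_smul_right]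
    by_cases hb : χ b = 0
    · simp [hb]
    by_cases hw0 : w = 0
    · simp [hw0]
    have hχ : χ ∈ {χ | N χ ≠ ⊥ ∧ χ ≠ 0} :=
      ⟨fun h => hw0 (by simpa [h] using hw), fun h => hb (by simp [h])⟩
    have h1 := ha ⟨χ, hχ⟩
    rw [hf] at h1
    have h2 : inner ℝ (T a v) w = χ a * inner ℝ v w := by
      rw [hT a, hw', inner_smul_right]
    rw [hv, inner_zero_left] at h2
    rcases mul_eq_zero.1 h2.symm with h3 | h3
    · exact absurd h3 h1
    · rw [h3, mul_zero]
  have h := hspan (x := T b v) trivial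
  simpa using h

/-- The solution of the linear equation `c' = D c` is `exp (t D) c(0)`. -/
theorem eq_exp_smul_apply_of_hasDerivAt {V : Type*} [NormedAddCommGroup V] [NormedSpace ℝ V]
    [CompleteSpace V] (D : V →L[ℝ] V) {c : ℝ → V} (hc : ∀ t, HasDerivAt c (D (c t)) t) (t : ℝ) :
    c t = NormedSpace.exp (t • D) (c 0) := by
  have hD : ∀ t : ℝ, HasDerivAt (fun t : ℝ => NormedSpace.exp (t • -D))
      (NormedSpace.exp (t • -D) * -D) t := fun t => hasDerivAt_exp_smul_const (𝕂 := ℝ) (-D) t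
  have hf : ∀ t, HasDerivAt (fun t => NormedSpace.exp (t • -D) (c t)) 0 t := fun t => by
    refine ((hD t).clm_apply (hc t)).congr_deriv ?_
    simp only [mul_apply_eq_comp, neg_apply, map_neg, neg_add_cancel]
  have h1 := is_const_of_deriv_eq_zero (fun t => (hf t).differentiableAt)
    (fun t => (hf t).deriv) t 0
  have h2 : NormedSpace.exp (t • D) * NormedSpace.exp (t • -D) = 1 := by
    let _ : NormedAlgebra ℚ (V →L[ℝ] V) := NormedAlgebra.restrictScalars ℚ ℝ _
    rw [smul_neg, ← NormedSpace.exp_add_of_commute ((Commute.refl _).neg_right)]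
    simp
  have h3 : NormedSpace.exp (t • D) (NormedSpace.exp (t • -D) (c t)) = c t := congr($h2 (c t))
  rw [← h3]
  congr 1
  simpa using h1

/-- The exponentials of operators acting compatibly on the source and target of a bilinear map
intertwine that map. -/
theorem exp_smul_bilinear {V W : Type*} [NormedAddCommGroup V] [NormedSpace ℝ V] [CompleteSpace V]
    [NormedAddCommGroup W] [NormedSpace ℝ W] [CompleteSpace W] (m : V →L[ℝ] V →L[ℝ] W)
    (D : V →L[ℝ] V) (D' : W →L[ℝ] W) (h : ∀ x y, m (D x) y + m x (D y) = D' (m x y)) (t : ℝ)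
    (x y : V) :
    m (NormedSpace.exp (t • D) x) (NormedSpace.exp (t • D) y) =
      NormedSpace.exp (t • D') (m x y) := by
  have hD : ∀ (z : V) (t : ℝ), HasDerivAt (fun t : ℝ => NormedSpace.exp (t • D) z)
      (D (NormedSpace.exp (t • D) z)) t := fun z t => by
    simpa using (hasDerivAt_exp_smul_const' (𝕂 := ℝ) D t).clm_apply (hasDerivAt_const t z)
  have h1 := eq_exp_smul_apply_of_hasDerivAt D'
    (c := fun t => m (NormedSpace.exp (t • D) x) (NormedSpace.exp (t • D) y)) (fun t =>
      ((m.hasFDerivAt.comp_hasDerivAt t (hD x t)).clm_apply (hD y t)).congr_deriv (h _ _)) t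
  simpa using h1

/-- Let `b` be a Lie bracket on a Euclidean space, for which `-θ` gives the adjoints of the
operators `b z`. Every element of the `(-1)`-eigenspace of `θ` can be moved by an automorphism
commuting with `θ` into the centralizer of a given element of that eigenspace. The automorphism
minimizes `f ↦ ⟪f X, Y⟫` on the compact group of isometric automorphisms that commute with `θ`; the
first variation along `exp (t b Z)`, with `Z = b (f X) Y`, vanishes at the minimum, and it is
the negative of the square norm of `Z`. -/
theorem exists_isometric_automorphism_bracket_eq_zero {V : Type*} [NormedAddCommGroup V]
    [InnerProductSpace ℝ V] [FiniteDimensional ℝ V] (b : V →ₗ[ℝ] V →ₗ[ℝ] V) (θ : V →ₗ[ℝ] V)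
    (hskew : ∀ x y, b x y = -b y x) (hleib : ∀ x y z, b z (b x y) = b (b z x) y + b x (b z y))
    (hθb : ∀ x y, θ (b x y) = b (θ x) (θ y))
    (hadj : ∀ x y z, inner ℝ (b z x) y = -inner ℝ x (b (θ z) y))
    {X Y : V} (hX : θ X = -X) (hY : θ Y = -Y) :
    ∃ f : V ≃ₗ[ℝ] V, (∀ x y, f (b x y) = b (f x) (f y)) ∧ (∀ x, θ (f x) = f (θ x)) ∧
      b (f X) Y = 0 := by
  let m : V →L[ℝ] V →L[ℝ] V := b.toContinuousBilinearMap
  have hm : ∀ x y, m x y = b x y := fun _ _ => rfl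
  let θ' : V →L[ℝ] V := θ.toContinuousLinearMap
  have hθ' : ∀ x, θ' x = θ x := fun _ => rfl
  let C : Set (V →L[ℝ] V) := {f | (∀ x y, f (b x y) = m (f x) (f y)) ∧
    (∀ x, θ' (f x) = f (θ x)) ∧ ∀ x y, inner ℝ (f x) (f y) = inner ℝ x y}
  have hclosed : IsClosed C := by
    have hC : C = (⋂ x, ⋂ y, {f | f (b x y) = m (f x) (f y)}) ∩ ((⋂ x, {f | θ' (f x) = f (θ x)}) ∩
        ⋂ x, ⋂ y, {f | inner ℝ (f x) (f y) = inner ℝ x y}) := by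
      ext f; simp [C]
    rw [hC]
    refine (isClosed_iInter fun x => isClosed_iInter fun y => ?_).inter
      ((isClosed_iInter fun x => ?_).inter (isClosed_iInter fun x => isClosed_iInter fun y => ?_))
    all_goals exact isClosed_eq (by fun_prop) (by fun_prop)
  have hbdd : Bornology.IsBounded C := by
    refine (Metric.isBounded_closedBall (x := (0 : V →L[ℝ] V)) (r := 1)).subset fun f hf => ?_
    rw [mem_closedBall_zero_iff]
    refine f.opNorm_le_bound zero_le_one fun x => ?_
    have h := hf.2.2 x x
    rw [real_inner_self_eq_norm_sq, real_inner_self_eq_norm_sq] at h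
    rw [one_mul]
    exact ((sq_eq_sq₀ (norm_nonneg _) (norm_nonneg _)).1 h).le
  have hone : (1 : V →L[ℝ] V) ∈ C := ⟨fun _ _ => rfl, fun _ => rfl, fun _ _ => rfl⟩
  obtain ⟨f, hf, hmin⟩ := (Metric.isCompact_of_isClosed_isBounded hclosed hbdd).exists_isMinOn
    ⟨1, hone⟩ (f := fun f => inner ℝ (f X) Y) (by fun_prop)
  have hinj : Function.Injective (f : V →ₗ[ℝ] V) := by
    rw [← LinearMap.ker_eq_bot, LinearMap.ker_eq_bot']
    intro x hx
    have h := hf.2.2 x x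
    rw [show f x = 0 from hx, inner_zero_left] at h
    exact inner_self_eq_zero.1 h.symm
  refine ⟨LinearEquiv.ofInjectiveEndo (f : V →ₗ[ℝ] V) hinj, hf.1, hf.2.1, ?_⟩
  change b (f X) Y = 0
  set Z : V := b (f X) Y with hZ
  have hθf : θ (f X) = -f X := by
    have h := hf.2.1 X
    rwa [hX, map_neg] at h
  have hθZ : θ Z = Z := by
    rw [hZ, hθb, hθf, hY, map_neg, map_neg, LinearMap.neg_apply, neg_neg]
  let D : V →L[ℝ] V := m Z
  have hexp : ∀ t : ℝ, NormedSpace.exp (t • D) * f ∈ C := by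
    intro t
    refine ⟨fun x y => ?_, fun x => ?_, fun x y => ?_⟩
    · have h := exp_smul_bilinear m D D (fun x y => (hleib x y Z).symm) t (f x) (f y)
      simp only [mul_apply_eq_comp, hf.1]
      exact h.symm
    · have hc : Commute θ' (t • D) := by
        refine Commute.smul_right ?_ t
        ext x
        simp only [mul_apply_eq_comp, hθ', D, hm, hθb, hθZ]
      have h := congr($(hc.exp_right.eq) (f x))
      simp only [mul_apply_eq_comp] at h ⊢
      rw [h, hf.2.1]
    · have h := exp_smul_bilinear (innerSL ℝ) D 0 (fun x y => by
        change inner ℝ (b Z x) y + inner ℝ x (b Z y) = 0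
        rw [hadj x, hθZ, neg_add_cancel]) t (f x) (f y)
      simp only [smul_zero, NormedSpace.exp_zero, one_apply_eq_self] at h
      exact h.trans (hf.2.2 x y)
  have hderiv : HasDerivAt (fun t : ℝ => inner ℝ ((NormedSpace.exp (t • D) * f) X) Y)
      (inner ℝ (D (f X)) Y) 0 := by
    have h1 : HasDerivAt (fun t : ℝ => NormedSpace.exp (t • D) (f X)) (D (f X)) 0 := by
      simpa using (hasDerivAt_exp_smul_const' (𝕂 := ℝ) D (0 : ℝ)).clm_apply
        (hasDerivAt_const (0 : ℝ) (f X))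
    simpa using h1.inner ℝ (hasDerivAt_const (0 : ℝ) Y)
  have hloc : IsLocalMin (fun t : ℝ => inner ℝ ((NormedSpace.exp (t • D) * f) X) Y) 0 :=
    Filter.Eventually.of_forall fun t => by
      simpa using hmin (hexp t)
  have hzero : inner ℝ (b Z (f X)) Y = 0 := hloc.hasDerivAt_eq_zero hderiv
  rw [hskew, inner_neg_left, hadj, hθf, map_neg, LinearMap.neg_apply, inner_neg_right, neg_neg,
    ← hZ, neg_eq_zero] at hzero
  exact inner_self_eq_zero.1 hzero

end LinearAlgebra

/-! ### Cartan involutions and split real forms -/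

section CartanInvolution

variable {L : Type*} [LieRing L] [LieAlgebra ℝ L]

theorem killingForm_lie_left (X Y Z : L) :
    killingForm ℝ L ⁅X, Y⁆ Z = killingForm ℝ L X ⁅Y, Z⁆ :=
  LieModule.traceForm_apply_lie_apply ℝ L L X Y Z

theorem killingForm_lie_left' (X Y Z : L) :
    killingForm ℝ L ⁅X, Y⁆ Z = -killingForm ℝ L Y ⁅X, Z⁆ :=
  LieModule.traceForm_apply_lie_apply' ℝ L L X Y Z

theorem killingForm_symm (X Y : L) : killingForm ℝ L X Y = killingForm ℝ L Y X :=
  LieModule.traceForm_comm ℝ L L X Y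

namespace IsCartanInvolution

variable {θ : L ≃ₗ⁅ℝ⁆ L} (hθ : IsCartanInvolution θ)
include hθ

theorem killingForm_apply_left (X Y : L) :
    killingForm ℝ L (θ X) Y = killingForm ℝ L X (θ Y) := by
  rw [← LieAlgebra.killingForm_of_equiv_apply θ X (θ Y), hθ.involutive]

/-- The inner product `(X, Y) ↦ -⟨X, θ Y⟩` given by a Cartan involution. -/
@[reducible] def innerCore : InnerProductSpace.Core ℝ L where
  inner X Y := -killingForm ℝ L X (θ Y)
  conj_inner_symm X Y := by
    simp only [conj_trivial, neg_inj]
    rw [killingForm_symm, hθ.killingForm_apply_left]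
  re_inner_nonneg X := by
    by_cases h : X = 0
    · simp [h]
    · exact (hθ.pos_def X h).le
  add_left X Y Z := by simp; ring
  smul_left X Y r := by simp
  definite X h := by
    by_contra h0
    exact (hθ.pos_def X h0).ne' h

end IsCartanInvolution

variable (L) in
/-- The Lie bracket as a bilinear map. -/
def lieBilinear : L →ₗ[ℝ] L →ₗ[ℝ] L :=
  LinearMap.mk₂ ℝ (fun X Y => ⁅X, Y⁆) add_lie smul_lie lie_add (fun c X Y => lie_smul c X Y)

namespace IsCartanInvolution

variable {θ : L ≃ₗ⁅ℝ⁆ L} (hθ : IsCartanInvolution θ)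
include hθ

theorem inner_lie (x y z : L) :
    hθ.innerCore.inner ⁅z, x⁆ y = -hθ.innerCore.inner x ⁅θ z, y⁆ := by
  change -killingForm ℝ L ⁅z, x⁆ (θ y) = - -killingForm ℝ L x (θ ⁅θ z, y⁆)
  rw [killingForm_lie_left', LieEquiv.map_lie, hθ.involutive]

/-- Every element of `𝔰` can be moved by an automorphism commuting with `θ` into the centralizer
of a given element of `𝔰`. -/
theorem exists_equiv_lie_eq_zero [FiniteDimensional ℝ L] {X Y : L} (hX : θ X = -X)
    (hY : θ Y = -Y) : ∃ φ : L ≃ₗ⁅ℝ⁆ L, (∀ Z, θ (φ Z) = φ (θ Z)) ∧ ⁅φ X, Y⁆ = 0 := by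
  obtain ⟨f, h1, h2, h3⟩ := @exists_isometric_automorphism_bracket_eq_zero L
    (@InnerProductSpace.Core.toNormedAddCommGroup ℝ L _ _ _ hθ.innerCore)
    (InnerProductSpace.ofCore hθ.innerCore.toCore) ‹_› (lieBilinear L)
    (θ : L →ₗ[ℝ] L) (fun x y => (lie_skew x y).symm) (fun x y z => leibniz_lie z x y)
    (fun x y => θ.map_lie x y) hθ.inner_lie X Y hX hY
  exact ⟨{ f with map_lie' := fun {x y} => h1 x y }, h2, h3⟩

/-- An abelian subspace of `𝔰` contains an element with the same centralizer. -/
theorem exists_regular [FiniteDimensional ℝ L] {𝔞 : LieSubalgebra ℝ L}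
    (h𝔞 : (𝔞 : Set L) ⊆ noncompactPart θ) (hab : ∀ H ∈ 𝔞, ∀ H' ∈ 𝔞, ⁅H, H'⁆ = 0) :
    ∃ H ∈ 𝔞, ∀ X : L, ⁅H, X⁆ = 0 → ∀ H' ∈ 𝔞, ⁅H', X⁆ = 0 := by
  let T : 𝔞 →ₗ[ℝ] Module.End ℝ L :=
    lieBilinear L ∘ₗ 𝔞.toSubmodule.subtype
  obtain ⟨H, hH⟩ := @exists_regular_of_isSymmetric L 𝔞
    (@InnerProductSpace.Core.toNormedAddCommGroup ℝ L _ _ _ hθ.innerCore)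
    (InnerProductSpace.ofCore hθ.innerCore.toCore) ‹_› _ _
    T (fun H x y => by
      have h := hθ.inner_lie x y H
      rw [h𝔞 H.2, neg_lie] at h
      refine h.trans ?_
      change - -killingForm ℝ L x (θ (-⁅(H : L), y⁆)) = -killingForm ℝ L x (θ ⁅(H : L), y⁆)
      rw [map_neg, map_neg, neg_neg])
    (fun H H' => LinearMap.ext fun x => by
      change ⁅(H : L), ⁅(H' : L), x⁆⁆ = ⁅(H' : L), ⁅(H : L), x⁆⁆
      rw [leibniz_lie, hab H H.2 H' H'.2, zero_lie, zero_add])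
  exact ⟨H, H.2, fun X hX H' hH' => hH X hX ⟨H', hH'⟩⟩

end IsCartanInvolution

namespace IsMaximalAbelianIn

theorem lie_eq_zero {S : Set L} {𝔞 : LieSubalgebra ℝ L} (h : IsMaximalAbelianIn S 𝔞) {X Y : L}
    (hX : X ∈ 𝔞) (hY : Y ∈ 𝔞) : ⁅X, Y⁆ = 0 := by
  have := h.1.2
  exact congrArg Subtype.val (trivial_lie_zero 𝔞 𝔞 ⟨X, hX⟩ ⟨Y, hY⟩)

/-- A maximal abelian subalgebra in a subspace `S` contains every element of `S` that centralizes
it. -/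
theorem mem_of_forall_lie_eq_zero {S : Submodule ℝ L} {𝔞 : LieSubalgebra ℝ L}
    (h : IsMaximalAbelianIn (S : Set L) 𝔞) {X : L} (hX : X ∈ S) (hc : ∀ H ∈ 𝔞, ⁅H, X⁆ = 0) :
    X ∈ 𝔞 := by
  have hlie : ∀ Y ∈ 𝔞.toSubmodule ⊔ Submodule.span ℝ {X},
      ∀ Z ∈ 𝔞.toSubmodule ⊔ Submodule.span ℝ {X}, ⁅Y, Z⁆ = 0 := by
    intro Y hY Z hZ
    obtain ⟨H, hH, _, hr, rfl⟩ := Submodule.mem_sup.1 hY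
    obtain ⟨r, rfl⟩ := Submodule.mem_span_singleton.1 hr
    obtain ⟨H', hH', _, hs, rfl⟩ := Submodule.mem_sup.1 hZ
    obtain ⟨s, rfl⟩ := Submodule.mem_span_singleton.1 hs
    have h1 : ⁅X, H'⁆ = 0 := by rw [← lie_skew, hc H' hH', neg_zero]
    simp [h.lie_eq_zero hH hH', hc H hH, h1]
  let 𝔟 : LieSubalgebra ℝ L :=
    { 𝔞.toSubmodule ⊔ Submodule.span ℝ {X} with
      lie_mem' := fun {Y Z} hY hZ => by
        rw [hlie Y hY Z hZ]
        exact Submodule.zero_mem _ }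
  have h𝔟 : (𝔟 : Set L) ⊆ S ∧ IsLieAbelian 𝔟 := by
    refine ⟨?_, ⟨fun Y Z => Subtype.ext (hlie Y Y.2 Z Z.2)⟩⟩
    exact sup_le (a := 𝔞.toSubmodule) (c := S) h.1.1 (by simpa using hX)
  have hle : 𝔞 ≤ 𝔟 := fun H hH => Submodule.mem_sup_left hH
  exact h.2 h𝔟 hle (Submodule.mem_sup_right (Submodule.mem_span_singleton_self X))

end IsMaximalAbelianIn

/-- In a split real form, every maximal abelian subspace `𝔞` of `𝔰` is its own centralizer in `𝔤`.
An automorphism commuting with `θ` moves a regular element of `𝔞` into the given split Cartan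
subalgebra `𝔥`, and it then moves `𝔞` onto `𝔥`. -/
theorem IsSplitRealFormOfSimple.mem_of_forall_lie_eq_zero [FiniteDimensional ℝ L]
    (hs : IsSplitRealFormOfSimple L) {θ : L ≃ₗ⁅ℝ⁆ L} (hθ : IsCartanInvolution θ)
    {𝔞 : LieSubalgebra ℝ L} (h𝔞 : IsMaximalAbelianIn (noncompactPart θ) 𝔞) {X : L}
    (hX : ∀ H ∈ 𝔞, ⁅H, X⁆ = 0) : X ∈ 𝔞 := by
  obtain ⟨𝔥, h𝔥s, h𝔥⟩ := hs.split θ hθ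
  let S : Submodule ℝ L := LinearMap.ker ((θ : L →ₗ[ℝ] L) + LinearMap.id)
  have hS : (S : Set L) = noncompactPart θ := by
    ext Y
    simp [S, noncompactPart, eq_neg_iff_add_eq_zero]
  rw [← hS] at h𝔞
  rw [← Submodule.top_coe (R := ℝ)] at h𝔥
  have h𝔞s : (𝔞 : Set L) ⊆ noncompactPart θ := hS ▸ h𝔞.1.1
  obtain ⟨H, hH, hreg⟩ := hθ.exists_regular h𝔞s fun _ h _ h' => h𝔞.lie_eq_zero h h'
  obtain ⟨H', hH', hreg'⟩ := hθ.exists_regular h𝔥s fun _ h _ h' => h𝔥.lie_eq_zero h h'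
  obtain ⟨φ, hφθ, hφ⟩ := hθ.exists_equiv_lie_eq_zero (h𝔞s hH) (h𝔥s hH')
  have hφH : φ H ∈ 𝔥 := h𝔥.mem_of_forall_lie_eq_zero trivial <| hreg' _ <| by
    rw [← lie_skew, hφ, neg_zero]
  have hsub : ∀ Y ∈ 𝔥, φ.symm Y ∈ 𝔞 := fun Y hY => by
    refine h𝔞.mem_of_forall_lie_eq_zero ?_ (hreg _ ?_)
    · have h1 : φ.symm Y ∈ noncompactPart θ := by
        change θ _ = -_
        refine φ.injective (?_ : φ _ = φ _)
        rw [← hφθ, map_neg, LieEquiv.apply_symm_apply]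
        exact h𝔥s hY
      rwa [← hS] at h1
    · refine φ.injective (?_ : φ _ = φ _)
      rw [LieEquiv.map_lie, LieEquiv.apply_symm_apply, map_zero]
      exact h𝔥.lie_eq_zero hφH hY
  have hφX : φ X ∈ 𝔥 := h𝔥.mem_of_forall_lie_eq_zero trivial fun Y hY => by
    have h1 := congrArg φ (hX _ (hsub Y hY))
    rwa [LieEquiv.map_lie, LieEquiv.apply_symm_apply, map_zero] at h1
  have h1 := hsub _ hφX
  rwa [LieEquiv.symm_apply_apply] at h1

end CartanInvolution

/-! ### Root spaces -/

section RootSpaces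

variable {L : Type*} [LieRing L] [LieAlgebra ℝ L] {θ : L ≃ₗ⁅ℝ⁆ L} {𝔞 : LieSubalgebra ℝ L}
  {α β : Module.Dual ℝ 𝔞}

theorem lie_of_mem_rootSpaceOf {X H : L} (hX : X ∈ rootSpaceOf 𝔞 α) (hH : H ∈ 𝔞) :
    ⁅H, X⁆ = α ⟨H, hH⟩ • X :=
  hX ⟨H, hH⟩

theorem smul_mem_rootSpaceOf {X : L} (hX : X ∈ rootSpaceOf 𝔞 α) (c : ℝ) :
    c • X ∈ rootSpaceOf 𝔞 α := fun H => by
  rw [lie_smul, hX H, smul_comm]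

theorem add_mem_rootSpaceOf {X Y : L} (hX : X ∈ rootSpaceOf 𝔞 α) (hY : Y ∈ rootSpaceOf 𝔞 α) :
    X + Y ∈ rootSpaceOf 𝔞 α := fun H => by
  rw [lie_add, hX H, hY H, smul_add]

theorem map_mem_rootSpaceOf_neg (hθ : IsCartanInvolution θ)
    (h𝔞 : (𝔞 : Set L) ⊆ noncompactPart θ) {X : L} (hX : X ∈ rootSpaceOf 𝔞 α) :
    θ X ∈ rootSpaceOf 𝔞 (-α) := fun H => by
  have h : θ (H : L) = -H := h𝔞 H.2
  calc ⁅(H : L), θ X⁆ = θ ⁅θ H, X⁆ := by rw [LieEquiv.map_lie, hθ.involutive]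
    _ = (-α) H • θ X := by rw [h, neg_lie, hX H, map_neg, map_smul]; simp

theorem lie_lie_eq_zero_of_mem_rootSpaceOf {X Y H : L} (hX : X ∈ rootSpaceOf 𝔞 α)
    (hY : Y ∈ rootSpaceOf 𝔞 (-α)) (hH : H ∈ 𝔞) : ⁅H, ⁅X, Y⁆⁆ = 0 := by
  rw [leibniz_lie, lie_of_mem_rootSpaceOf hX hH, lie_of_mem_rootSpaceOf hY hH]
  simp

theorem killingForm_lie_of_mem_rootSpaceOf {X Y H : L}
    (hY : Y ∈ rootSpaceOf 𝔞 (-α)) (hH : H ∈ 𝔞) :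
    killingForm ℝ L ⁅X, Y⁆ H = α ⟨H, hH⟩ * killingForm ℝ L X Y := by
  rw [killingForm_lie_left, ← lie_skew, lie_of_mem_rootSpaceOf hY hH]
  simp

/-- An element of `𝔞 ⊆ 𝔰` that is isotropic for the Killing form vanishes. -/
theorem IsCartanInvolution.eq_zero_of_killingForm_self (hθ : IsCartanInvolution θ) {X : L}
    (hX : θ X = -X) (h : killingForm ℝ L X X = 0) : X = 0 := by
  by_contra h0
  have := hθ.pos_def X h0
  rw [hX, map_neg, h] at this
  simp at this

section SelfCentralizing

variable (hθ : IsCartanInvolution θ) (h𝔞 : (𝔞 : Set L) ⊆ noncompactPart θ)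
  (hc : ∀ X : L, (∀ H ∈ 𝔞, ⁅H, X⁆ = 0) → X ∈ 𝔞)
include hθ h𝔞 hc

/-- In a self-centralizing `𝔞`, the brackets `[𝔤_α, 𝔤_{-α}]` lie in `𝔞`. -/
theorem lie_map_mem {X Y : L} (hX : X ∈ rootSpaceOf 𝔞 α) (hY : Y ∈ rootSpaceOf 𝔞 α) :
    ⁅X, θ Y⁆ ∈ 𝔞 :=
  hc _ fun _ => lie_lie_eq_zero_of_mem_rootSpaceOf hX (map_mem_rootSpaceOf_neg hθ h𝔞 hY)

/-- The coroot direction `[X, θ X]` pairs negatively with the root. -/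
theorem root_lie_map_neg (hα : α ≠ 0) {X : L} (hX : X ∈ rootSpaceOf 𝔞 α) (hX0 : X ≠ 0) :
    α ⟨⁅X, θ X⁆, lie_map_mem hθ h𝔞 hc hX hX⟩ < 0 := by
  have hm := lie_map_mem hθ h𝔞 hc hX hX
  have hθX := map_mem_rootSpaceOf_neg hθ h𝔞 hX
  have hq := hθ.pos_def X hX0
  obtain ⟨H, hH⟩ : ∃ H, α H ≠ 0 := by
    by_contra! h
    exact hα (LinearMap.ext h)
  have h0 : ⁅X, θ X⁆ ≠ 0 := fun h => by
    have h1 := killingForm_lie_of_mem_rootSpaceOf (X := X) hθX H.2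
    rw [h, map_zero, LinearMap.zero_apply] at h1
    rcases mul_eq_zero.1 h1.symm with h2 | h2
    · exact hH h2
    · rw [h2] at hq; simp at hq
  have hs : θ ⁅X, θ X⁆ = -⁅X, θ X⁆ := h𝔞 hm
  have h1 := hθ.pos_def _ h0
  rw [hs, map_neg, neg_neg, killingForm_lie_of_mem_rootSpaceOf hθX hm] at h1
  nlinarith

/-- An element of `𝔤_α` orthogonal to a nonzero `E ∈ 𝔤_α` vanishes: `[θ E, X]` lies in `𝔞` and is
orthogonal to `𝔞`, so it is zero, and then `‖[E, X]‖²` is a negative multiple of `‖X‖²`. -/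
theorem eq_zero_of_killingForm_map_eq_zero (hα : α ≠ 0) {E X : L} (hE : E ∈ rootSpaceOf 𝔞 α)
    (hE0 : E ≠ 0) (hX : X ∈ rootSpaceOf 𝔞 α) (h : killingForm ℝ L X (θ E) = 0) : X = 0 := by
  have hθE := map_mem_rootSpaceOf_neg hθ h𝔞 hE
  have hθX := map_mem_rootSpaceOf_neg hθ h𝔞 hX
  have hm := lie_map_mem hθ h𝔞 hc hX hE
  have hY : ⁅X, θ E⁆ = 0 := hθ.eq_zero_of_killingForm_self (h𝔞 hm) <| by
    rw [killingForm_lie_of_mem_rootSpaceOf hθE hm, h, mul_zero]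
  have hY' : ⁅E, θ X⁆ = 0 := by
    have h1 := congrArg θ hY
    rw [LieEquiv.map_lie, hθ.involutive, map_zero, ← lie_skew, neg_eq_zero] at h1
    exact h1
  have hm' := lie_map_mem hθ h𝔞 hc hE hE
  have h2 : killingForm ℝ L ⁅E, X⁆ (θ ⁅E, X⁆) =
      α ⟨⁅E, θ E⁆, hm'⟩ * killingForm ℝ L X (θ X) := by
    rw [LieEquiv.map_lie, killingForm_lie_left', leibniz_lie, hY', lie_zero, add_zero,
      lie_of_mem_rootSpaceOf hθX hm']
    simp
  by_contra hX0
  have h3 := hθ.pos_def X hX0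
  have h4 := root_lie_map_neg hθ h𝔞 hc hα hE hE0
  have h5 : 0 ≤ -killingForm ℝ L ⁅E, X⁆ (θ ⁅E, X⁆) := by
    by_cases h6 : ⁅E, X⁆ = 0
    · simp [h6]
    · exact (hθ.pos_def _ h6).le
  rw [h2] at h5
  nlinarith

theorem exists_eq_smul_of_mem_rootSpaceOf (hα : α ≠ 0) {E X : L} (hE : E ∈ rootSpaceOf 𝔞 α)
    (hE0 : E ≠ 0) (hX : X ∈ rootSpaceOf 𝔞 α) : ∃ c : ℝ, X = c • E := by
  have hq := hθ.pos_def E hE0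
  refine ⟨killingForm ℝ L X (θ E) / killingForm ℝ L E (θ E), ?_⟩
  rw [← sub_eq_zero]
  refine eq_zero_of_killingForm_map_eq_zero hθ h𝔞 hc hα hE hE0 ?_ ?_
  · rw [sub_eq_add_neg, ← neg_smul]
    exact add_mem_rootSpaceOf hX (smul_mem_rootSpaceOf hE _)
  · have : killingForm ℝ L E (θ E) ≠ 0 := by intro h; rw [h] at hq; simp at hq
    simp only [map_sub, map_smul, LinearMap.sub_apply, LinearMap.smul_apply, smul_eq_mul]
    field_simp
    ring

/-- The root spaces `𝔤_α` and `𝔤_{-α}` are spanned by the outer members of an `sl₂`-triple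
`(h, e, -θ e)` with `h ∈ 𝔞`. -/
theorem exists_isSl2Triple (hα : IsRootOf 𝔞 α) :
    ∃ h e : L, IsSl2Triple h e (-θ e) ∧ (∃ hh : h ∈ 𝔞, α ⟨h, hh⟩ = 2) ∧ e ∈ rootSpaceOf 𝔞 α ∧
      (∀ X ∈ rootSpaceOf 𝔞 α, ∃ c : ℝ, X = c • e) ∧
      ∀ X ∈ rootSpaceOf 𝔞 (-α), ∃ c : ℝ, X = c • -θ e := by
  obtain ⟨hα0, E, hE, hE0⟩ := hα
  have hneg := root_lie_map_neg hθ h𝔞 hc hα0 hE hE0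
  set a := α ⟨⁅E, θ E⁆, lie_map_mem hθ h𝔞 hc hE hE⟩ with ha
  -- This scaling gives the coroot the value `2` under `α`.
  set c := √(2 / -a)
  have hc2 : c * c = 2 / -a := Real.mul_self_sqrt (by apply div_nonneg <;> linarith)
  have hc0 : c ≠ 0 := by
    intro h
    rw [h, mul_zero, eq_comm, div_eq_zero_iff] at hc2
    rcases hc2 with h | h <;> linarith
  have he : c • E ∈ rootSpaceOf 𝔞 α := smul_mem_rootSpaceOf hE c
  have he0 : c • E ≠ 0 := smul_ne_zero hc0 hE0
  have hm : (-(c * c)) • ⁅E, θ E⁆ ∈ 𝔞 := 𝔞.smul_mem _ (lie_map_mem hθ h𝔞 hc hE hE)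
  have h2 : α ⟨_, hm⟩ = 2 := by
    have h3 : (⟨_, hm⟩ : 𝔞) = (-(c * c)) • ⟨⁅E, θ E⁆, lie_map_mem hθ h𝔞 hc hE hE⟩ := rfl
    have h4 : -a ≠ 0 := by linarith
    rw [h3, map_smul, ← ha, hc2, smul_eq_mul, neg_mul_comm, div_mul_cancel₀ _ h4]
  have hf : -θ (c • E) ∈ rootSpaceOf 𝔞 (-α) := by
    rw [← map_neg, ← smul_neg, ← neg_smul_neg, neg_neg]
    exact map_mem_rootSpaceOf_neg hθ h𝔞 (smul_mem_rootSpaceOf hE _)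
  refine ⟨(-(c * c)) • ⁅E, θ E⁆, c • E, ⟨?_, ?_, ?_, ?_⟩, ⟨hm, h2⟩, he, fun X hX =>
    exists_eq_smul_of_mem_rootSpaceOf hθ h𝔞 hc hα0 he he0 hX, fun X hX => ?_⟩
  · intro h
    have h3 : (⟨_, hm⟩ : 𝔞) = 0 := Subtype.ext h
    rw [h3, map_zero] at h2
    norm_num at h2
  · rw [map_smul, lie_neg, smul_lie, lie_smul, smul_smul, neg_smul]
  · rw [lie_of_mem_rootSpaceOf he hm, h2]
    norm_num [two_smul]
  · rw [lie_of_mem_rootSpaceOf hf hm, LinearMap.neg_apply, h2]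
    norm_num [two_smul]
  · have h3 := map_mem_rootSpaceOf_neg hθ h𝔞 hX
    rw [neg_neg] at h3
    obtain ⟨r, hr⟩ := exists_eq_smul_of_mem_rootSpaceOf hθ h𝔞 hc hα0 he he0 h3
    refine ⟨-r, ?_⟩
    rw [neg_smul_neg, ← map_smul θ, ← hr, hθ.involutive]

end SelfCentralizing

end RootSpaces

/-! ### The homomorphism of an `sl₂`-triple -/

section Sl2

variable {L : Type*} [LieRing L] [LieAlgebra ℝ L] {h e f : L}

/-- The linear map `M ↦ M₀₁ e + M₁₀ f + ½ (M₀₀ - M₁₁) h` from real `2 × 2` matrices, which kills the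
scalar matrices. For an `sl₂`-triple it carries commutators to brackets. -/
def sl2Map (h e f : L) : Matrix (Fin 2) (Fin 2) ℝ →ₗ[ℝ] L where
  toFun M := M 0 1 • e + M 1 0 • f + ((M 0 0 - M 1 1) / 2) • h
  map_add' M N := by simp only [Matrix.add_apply]; module
  map_smul' c M := by simp only [Matrix.smul_apply, smul_eq_mul, RingHom.id_apply]; module

theorem sl2Map_apply (M : Matrix (Fin 2) (Fin 2) ℝ) :
    sl2Map h e f M = M 0 1 • e + M 1 0 • f + ((M 0 0 - M 1 1) / 2) • h := rfl

theorem mem_sl_fin_two {M : Matrix (Fin 2) (Fin 2) ℝ} (hM : M 0 0 + M 1 1 = 0) :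
    M ∈ LieAlgebra.SpecialLinear.sl (Fin 2) ℝ := by
  rw [← Matrix.trace_fin_two] at hM
  exact hM

namespace IsSl2Triple

variable (t : IsSl2Triple h e f)
include t

theorem lie_sl2Map (M N : Matrix (Fin 2) (Fin 2) ℝ) :
    ⁅sl2Map h e f M, sl2Map h e f N⁆ = sl2Map h e f (M * N - N * M) := by
  have h1 : ⁅f, e⁆ = -h := by rw [← lie_skew, t.lie_e_f]
  have h2 : ⁅e, h⁆ = -((2 : ℝ) • e) := by rw [← lie_skew, t.lie_h_e_smul ℝ]
  have h3 : ⁅f, h⁆ = (2 : ℝ) • f := by rw [← lie_skew, t.lie_lie_smul_f ℝ, neg_neg]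
  simp only [sl2Map_apply, lie_add, add_lie, lie_smul, smul_lie, lie_self, t.lie_e_f,
    t.lie_h_e_smul ℝ, t.lie_lie_smul_f ℝ, h1, h2, h3, Matrix.sub_apply, Matrix.mul_apply,
    Fin.sum_univ_two]
  module

/-- The map `sl2Map` is injective on traceless matrices. -/
theorem eq_zero_of_sl2Map_eq_zero {M : Matrix (Fin 2) (Fin 2) ℝ} (hM : sl2Map h e f M = 0) :
    M 0 1 = 0 ∧ M 1 0 = 0 ∧ M 0 0 - M 1 1 = 0 := by
  rw [sl2Map_apply] at hM
  have h1 := congrArg (fun X => ⁅h, X⁆) hM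
  simp only [lie_add, lie_smul, t.lie_h_e_smul ℝ, t.lie_lie_smul_f ℝ, lie_self, smul_zero,
    add_zero, lie_zero] at h1
  have h2 := congrArg (fun X => ⁅h, X⁆) h1
  simp only [lie_add, lie_smul, lie_neg, t.lie_h_e_smul ℝ, t.lie_lie_smul_f ℝ, lie_zero] at h2
  have h3 : (8 * M 0 1) • e = 0 := by
    linear_combination (norm := module) (2 : ℝ) • h1 + h2
  have h4 : (8 * M 1 0) • f = 0 := by
    linear_combination (norm := module) h2 - (2 : ℝ) • h1
  have h5 : M 0 1 = 0 := by simpa [t.e_ne_zero] using h3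
  have h6 : M 1 0 = 0 := by simpa [t.f_ne_zero] using h4
  refine ⟨h5, h6, ?_⟩
  simpa [h5, h6, t.h_ne_zero] using hM

/-- The embedding of `sl(2, ℝ)` given by an `sl₂`-triple. -/
def sl2Hom : LieAlgebra.SpecialLinear.sl (Fin 2) ℝ →ₗ⁅ℝ⁆ L :=
  { toFun := fun M => sl2Map h e f M.1
    map_add' := fun M N => map_add (sl2Map h e f) M.1 N.1
    map_smul' := fun c M => map_smul (sl2Map h e f) c M.1
    map_lie' := fun {M N} => (t.lie_sl2Map M.1 N.1).symm }

theorem sl2Hom_injective : Function.Injective t.sl2Hom := by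
  rw [← LieHom.coe_toLinearMap, ← LinearMap.ker_eq_bot, LinearMap.ker_eq_bot']
  rintro ⟨M, hM⟩ h0
  obtain ⟨h1, h2, h3⟩ := t.eq_zero_of_sl2Map_eq_zero h0
  have h4 : M.trace = 0 := hM
  rw [Matrix.trace_fin_two] at h4
  refine Subtype.ext (Matrix.ext fun i j => ?_)
  fin_cases i <;> fin_cases j <;> simp <;> linarith

theorem range_sl2Hom : t.sl2Hom.range = LieSubalgebra.lieSpan ℝ L {e, f} := by
  refine le_antisymm ?_ (LieSubalgebra.lieSpan_le.2 ?_)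
  · rintro _ ⟨M, rfl⟩
    have he := LieSubalgebra.subset_lieSpan (R := ℝ) (show e ∈ ({e, f} : Set L) by simp)
    have hf := LieSubalgebra.subset_lieSpan (R := ℝ) (show f ∈ ({e, f} : Set L) by simp)
    have hh := LieSubalgebra.lie_mem _ he hf
    rw [t.lie_e_f] at hh
    exact add_mem (add_mem (LieSubalgebra.smul_mem _ _ he) (LieSubalgebra.smul_mem _ _ hf))
      (LieSubalgebra.smul_mem _ _ hh)
  · rintro _ (rfl | rfl)
    · refine ⟨⟨!![0, 1; 0, 0], mem_sl_fin_two (by simp)⟩, ?_⟩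
      change sl2Map _ _ _ _ = _
      simp [sl2Map_apply]
    · refine ⟨⟨!![0, 0; 1, 0], mem_sl_fin_two (by simp)⟩, ?_⟩
      change sl2Map _ _ _ _ = _
      simp [sl2Map_apply]

theorem mem_lieSpan_iff {X : L} :
    X ∈ LieSubalgebra.lieSpan ℝ L {e, f} ↔ ∃ M, X = sl2Map h e f M := by
  rw [← t.range_sl2Hom]
  refine ⟨?_, ?_⟩
  · rintro ⟨M, rfl⟩
    exact ⟨M.1, rfl⟩
  · rintro ⟨M, rfl⟩
    refine ⟨⟨!![(M 0 0 - M 1 1) / 2, M 0 1; M 1 0, -((M 0 0 - M 1 1) / 2)],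
      mem_sl_fin_two (by simp)⟩, ?_⟩
    change sl2Map _ _ _ _ = _
    simp [sl2Map_apply]

end IsSl2Triple

theorem rootSubalgebra_eq_lieSpan {𝔞 : LieSubalgebra ℝ L} {α : Module.Dual ℝ 𝔞}
    (he : e ∈ rootSpaceOf 𝔞 α) (hf : f ∈ rootSpaceOf 𝔞 (-α))
    (he' : ∀ X ∈ rootSpaceOf 𝔞 α, ∃ c : ℝ, X = c • e)
    (hf' : ∀ X ∈ rootSpaceOf 𝔞 (-α), ∃ c : ℝ, X = c • f) :
    rootSubalgebra 𝔞 α = LieSubalgebra.lieSpan ℝ L {e, f} := by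
  refine le_antisymm (LieSubalgebra.lieSpan_le.2 ?_) (LieSubalgebra.lieSpan_mono ?_)
  · rintro X (hX | hX)
    · obtain ⟨c, rfl⟩ := he' X hX
      exact LieSubalgebra.smul_mem _ _ (LieSubalgebra.subset_lieSpan (by simp))
    · obtain ⟨c, rfl⟩ := hf' X hX
      exact LieSubalgebra.smul_mem _ _ (LieSubalgebra.subset_lieSpan (by simp))
  · rintro X (rfl | rfl)
    · exact Or.inl he
    · exact Or.inr hf

end Sl2

/-! ### Translations and logarithmic derivatives -/

section LieGroup

variable {E : Type*} [NormedAddCommGroup E] [NormedSpace ℝ E]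
  {G : Type*} [TopologicalSpace G] [ChartedSpace E G] [Group G]

/-- The derivative at `h` of left translation by `g`, as an endomorphism of the model space. -/
def leftDeriv (g h : G) : E →L[ℝ] E := mfderiv 𝓘(ℝ, E) 𝓘(ℝ, E) (fun x : G => g * x) h

/-- The derivative at `g` of right translation by `h`, as an endomorphism of the model space. -/
def rightDeriv (g h : G) : E →L[ℝ] E := mfderiv 𝓘(ℝ, E) 𝓘(ℝ, E) (fun x : G => x * h) g

/-- The adjoint action `Ad g`, as an endomorphism of the model space. It agrees with `adjointMap g`
by definition; the model space, unlike its synonym `GroupLieAlgebra 𝓘(ℝ, E) G`, carries the norm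
needed for calculus. -/
def adjointCLM (g : G) : E →L[ℝ] E :=
  mfderiv 𝓘(ℝ, E) 𝓘(ℝ, E) (fun x : G => g * x * g⁻¹) 1

/-- The curve `γ` has left logarithmic derivative `X` at `t`: its velocity there is `γ(t) X`. -/
def HasLogDerivAt (γ : ℝ → G) (X : E) (t : ℝ) : Prop :=
  HasMFDerivAt 𝓘(ℝ, ℝ) 𝓘(ℝ, E) γ t
    ((1 : ℝ →L[ℝ] ℝ).smulRight (leftDeriv (γ t) 1 X) : ℝ →L[ℝ] E)

/-- The tangent spaces of `G` are all the model space, and so the two notions agree by unfolding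
definitions. -/
theorem isMIntegralCurve_iff_hasLogDerivAt {γ : ℝ → G} {X : GroupLieAlgebra 𝓘(ℝ, E) G} :
    IsMIntegralCurve (I := 𝓘(ℝ, E)) γ (fun x : G => mulInvariantVectorField X x) ↔
      ∀ t, HasLogDerivAt (E := E) γ X t :=
  Iff.rfl

theorem HasLogDerivAt.comp {γ : ℝ → G} {X : E} {s : ℝ → ℝ} {s' t : ℝ}
    (h : HasLogDerivAt γ X (s t)) (hs : HasDerivAt s s' t) :
    HasLogDerivAt (fun t => γ (s t)) (s' • X) t := by
  have h1 := HasMFDerivAt.comp t h hs.hasFDerivAt.hasMFDerivAt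
  refine HasMFDerivAt.congr_mfderiv h1 ?_
  refine ContinuousLinearMap.ext_ring (M₁ := E) ?_
  change ((1 : ℝ) • s') • leftDeriv (γ (s t)) 1 X = (1 : ℝ) • leftDeriv (γ (s t)) 1 (s' • X)
  rw [map_smul]
  simp

theorem hasLogDerivAt_const (g : G) (t : ℝ) : HasLogDerivAt (fun _ => g) (0 : E) t := by
  refine HasMFDerivAt.congr_mfderiv (hasMFDerivAt_const g t) ?_
  refine ContinuousLinearMap.ext_ring (M₁ := E) ?_
  change (0 : E) = (1 : ℝ) • leftDeriv g 1 (0 : E)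
  simp

variable [LieGroup 𝓘(ℝ, E) ∞ G]

theorem hasMFDerivAt_mul_left (g h : G) :
    HasMFDerivAt 𝓘(ℝ, E) 𝓘(ℝ, E) (fun x : G => g * x) h (leftDeriv g h : E →L[ℝ] E) :=
  ((contMDiff_mul_left (I := 𝓘(ℝ, E)) (n := ∞) (a := g)).mdifferentiableAt
    (by simp)).hasMFDerivAt

theorem hasMFDerivAt_mul_right (g h : G) :
    HasMFDerivAt 𝓘(ℝ, E) 𝓘(ℝ, E) (fun x : G => x * h) g (rightDeriv g h : E →L[ℝ] E) :=
  ((contMDiff_mul_right (I := 𝓘(ℝ, E)) (n := ∞) (a := h)).mdifferentiableAt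
    (by simp)).hasMFDerivAt

theorem hasMFDerivAt_conj (g : G) :
    HasMFDerivAt 𝓘(ℝ, E) 𝓘(ℝ, E) (fun x : G => g * x * g⁻¹) 1 (adjointCLM g : E →L[ℝ] E) :=
  (((contMDiff_mul_right (I := 𝓘(ℝ, E)) (n := ∞) (a := g⁻¹)).comp
    (contMDiff_mul_left (I := 𝓘(ℝ, E)) (n := ∞) (a := g))).mdifferentiableAt
    (by simp)).hasMFDerivAt

theorem leftDeriv_comp_leftDeriv (g h k : G) :
    (leftDeriv g (h * k) : E →L[ℝ] E) ∘L leftDeriv h k = leftDeriv (g * h) k := by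
  have h1 := HasMFDerivAt.comp k (hasMFDerivAt_mul_left (E := E) g (h * k))
    (hasMFDerivAt_mul_left h k)
  have h2 := hasMFDerivAt_mul_left (E := E) (g * h) k
  rw [show (fun x : G => g * h * x) = (fun x => g * x) ∘ (fun x => h * x) from
    funext fun x => mul_assoc _ _ _] at h2
  exact hasMFDerivAt_unique h1 h2

theorem leftDeriv_comp_rightDeriv (g x h : G) :
    (leftDeriv g (x * h) : E →L[ℝ] E) ∘L rightDeriv x h =
      rightDeriv (g * x) h ∘L leftDeriv g x := by
  have h1 := HasMFDerivAt.comp x (hasMFDerivAt_mul_left (E := E) g (x * h))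
    (hasMFDerivAt_mul_right x h)
  have h2 := HasMFDerivAt.comp x (hasMFDerivAt_mul_right (E := E) (g * x) h)
    (hasMFDerivAt_mul_left g x)
  rw [show (fun x : G => x * h) ∘ (fun x => g * x) = (fun x => g * x) ∘ (fun x => x * h) from
    funext fun x => mul_assoc _ _ _] at h2
  exact hasMFDerivAt_unique h1 h2

theorem rightDeriv_comp_rightDeriv (x h k : G) :
    (rightDeriv (x * h) k : E →L[ℝ] E) ∘L rightDeriv x h = rightDeriv x (h * k) := by
  have h1 := HasMFDerivAt.comp x (hasMFDerivAt_mul_right (E := E) (x * h) k)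
    (hasMFDerivAt_mul_right x h)
  have h2 := hasMFDerivAt_mul_right (E := E) x (h * k)
  rw [show (fun x : G => x * (h * k)) = (fun x => x * k) ∘ (fun x => x * h) from
    funext fun x => (mul_assoc _ _ _).symm] at h2
  exact hasMFDerivAt_unique h1 h2

theorem leftDeriv_one (g : G) : (leftDeriv 1 g : E →L[ℝ] E) = 1 := by
  have h := hasMFDerivAt_mul_left (E := E) 1 g
  rw [show (fun x : G => 1 * x) = id from funext fun x => one_mul _] at h
  exact hasMFDerivAt_unique h (hasMFDerivAt_id g)

theorem rightDeriv_one (g : G) : (rightDeriv g 1 : E →L[ℝ] E) = 1 := by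
  have h := hasMFDerivAt_mul_right (E := E) g 1
  rw [show (fun x : G => x * 1) = id from funext fun x => mul_one _] at h
  exact hasMFDerivAt_unique h (hasMFDerivAt_id g)

theorem adjointCLM_eq (g : G) :
    (adjointCLM g : E →L[ℝ] E) = rightDeriv g g⁻¹ ∘L leftDeriv g 1 := by
  have h := HasMFDerivAt.comp 1 (hasMFDerivAt_mul_right (E := E) (g * 1) g⁻¹)
    (hasMFDerivAt_mul_left g 1)
  have h2 := hasMFDerivAt_unique (hasMFDerivAt_conj g) h
  rw [mul_one] at h2
  exact h2

theorem leftDeriv_comp_adjointCLM (g h : G) :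
    (leftDeriv (g * h) 1 : E →L[ℝ] E) ∘L adjointCLM h⁻¹ = rightDeriv g h ∘L leftDeriv g 1 := by
  have h1 := leftDeriv_comp_rightDeriv (E := E) (g * h) h⁻¹ h
  have h2 := leftDeriv_comp_leftDeriv (E := E) (g * h) h⁻¹ 1
  rw [inv_mul_cancel, mul_inv_cancel_right] at h1
  rw [mul_one, mul_inv_cancel_right] at h2
  rw [adjointCLM_eq, inv_inv, ← ContinuousLinearMap.comp_assoc, h1,
    ContinuousLinearMap.comp_assoc, h2]

theorem adjointCLM_mul (g h : G) :
    (adjointCLM (g * h) : E →L[ℝ] E) = adjointCLM g ∘L adjointCLM h := by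
  have h0 : (fun x : G => g * h * x * (g * h)⁻¹) =
      (fun x => g * x * g⁻¹) ∘ (fun x => h * x * h⁻¹) := by
    funext x; simp only [Function.comp_apply]; group
  have h1 := hasMFDerivAt_conj (E := E) (g * h)
  rw [h0] at h1
  have hg := hasMFDerivAt_conj (E := E) g
  have h2 : h * 1 * h⁻¹ = 1 := by group
  rw [← h2] at hg
  exact hasMFDerivAt_unique h1 (HasMFDerivAt.comp 1 hg (hasMFDerivAt_conj h))

theorem adjointCLM_one : (adjointCLM (1 : G) : E →L[ℝ] E) = 1 := by
  rw [adjointCLM_eq, inv_one, rightDeriv_one, leftDeriv_one]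
  rfl

theorem adjointCLM_inv_apply_adjointCLM (g : G) (X : E) :
    adjointCLM g⁻¹ (adjointCLM g X) = X := by
  rw [← ContinuousLinearMap.comp_apply, ← adjointCLM_mul, inv_mul_cancel, adjointCLM_one]
  rfl

/-- The product rule `(γ δ)⁻¹ (γ δ)' = Ad(δ⁻¹) (γ⁻¹ γ') + δ⁻¹ δ'`. -/
theorem HasLogDerivAt.mul {γ δ : ℝ → G} {X Y : E} {t : ℝ} (hγ : HasLogDerivAt γ X t)
    (hδ : HasLogDerivAt δ Y t) :
    HasLogDerivAt (fun t => γ t * δ t) (adjointCLM (δ t)⁻¹ X + Y) t := by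
  have hm : MDifferentiableAt (𝓘(ℝ, E).prod 𝓘(ℝ, E)) 𝓘(ℝ, E) (fun p : G × G => p.1 * p.2)
      (γ t, δ t) := (contMDiff_mul 𝓘(ℝ, E) ∞).mdifferentiableAt (by simp)
  have h := HasMFDerivAt.comp t hm.hasMFDerivAt (HasMFDerivAt.prodMk hγ hδ)
  refine HasMFDerivAt.congr_mfderiv h ?_
  refine ContinuousLinearMap.ext_ring (M₁ := E) ?_
  refine (mfderiv_prod_eq_add_apply hm).trans ?_
  change rightDeriv (γ t) (δ t) ((1 : ℝ) • leftDeriv (γ t) 1 X) +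
    leftDeriv (γ t) (δ t) ((1 : ℝ) • leftDeriv (δ t) 1 Y) =
    (1 : ℝ) • leftDeriv (γ t * δ t) 1 (adjointCLM (δ t)⁻¹ X + Y)
  have h1 := congr($(leftDeriv_comp_adjointCLM (E := E) (γ t) (δ t)) X)
  have h2 := congr($(leftDeriv_comp_leftDeriv (E := E) (γ t) (δ t) 1) Y)
  simp only [ContinuousLinearMap.comp_apply, mul_one] at h1 h2
  rw [one_smul, one_smul, one_smul, map_add, h1, h2]

theorem HasLogDerivAt.const_mul {γ : ℝ → G} {X : E} {t : ℝ} (hγ : HasLogDerivAt γ X t) (g : G) :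
    HasLogDerivAt (fun t => g * γ t) X t := by
  simpa using (hasLogDerivAt_const g t).mul hγ

end LieGroup

/-! ### One-parameter subgroups -/

section ExponentialCurves

variable {E : Type*} [NormedAddCommGroup E] [NormedSpace ℝ E]
  {G : Type*} [TopologicalSpace G] [ChartedSpace E G] [Group G] [LieGroup 𝓘(ℝ, E) ∞ G]

theorem contMDiff_one_mulInvariantVectorField (X : GroupLieAlgebra 𝓘(ℝ, E) G) :
    ContMDiff 𝓘(ℝ, E) 𝓘(ℝ, E).tangent 1
      (fun g : G => (⟨g, mulInvariantVectorField X g⟩ : TangentBundle 𝓘(ℝ, E) G)) :=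
  (contMDiff_mulInvariantVectorField X).of_le (by
    rw [minSmoothness_of_isRCLikeNormedField]
    norm_num)

variable [T2Space G]

/-- A curve in `G` with constant left logarithmic derivative is determined by its initial value. -/
theorem eq_of_hasLogDerivAt {γ δ : ℝ → G} {X : E} (hγ : ∀ t, HasLogDerivAt γ X t)
    (hδ : ∀ t, HasLogDerivAt δ X t) (h : γ 0 = δ 0) : γ = δ := by
  have : IsManifold 𝓘(ℝ, E) 1 G := IsManifold.of_le (n := ∞) (by simp)
  exact isMIntegralCurve_Ioo_eq_of_contMDiff_boundaryless (t₀ := 0)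
    (contMDiff_one_mulInvariantVectorField (G := G) X) (isMIntegralCurve_iff_hasLogDerivAt.2 hγ)
    (isMIntegralCurve_iff_hasLogDerivAt.2 hδ) h

variable [CompleteSpace E]

/-- Left invariant vector fields are complete: translating a local integral curve through `1` shows
that all integral curves exist for a uniform time. -/
theorem exists_hasLogDerivAt (X : E) : ∃ γ : ℝ → G, γ 0 = 1 ∧ ∀ t, HasLogDerivAt γ X t := by
  have : IsManifold 𝓘(ℝ, E) 1 G := IsManifold.of_le (n := ∞) (by simp)
  have hv := contMDiff_one_mulInvariantVectorField (G := G) (X : GroupLieAlgebra 𝓘(ℝ, E) G)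
  obtain ⟨γ, h0, hγ⟩ := exists_isMIntegralCurveAt_of_contMDiffAt_boundaryless (t₀ := 0)
    (hv.contMDiffAt (x := 1))
  obtain ⟨ε, hε, hγ⟩ := isMIntegralCurveAt_iff'.1 hγ
  have hlog : ∀ t ∈ Set.Ioo (-ε) ε, HasLogDerivAt γ X t := fun t ht => by
    refine (hγ t ?_).hasMFDerivAt (Metric.isOpen_ball.mem_nhds ?_) <;>
    simpa [Real.ball_eq_Ioo] using ht
  obtain ⟨δ, hδ0, hδ⟩ := exists_isMIntegralCurve_of_isMIntegralCurveOn hv hε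
    (fun g => ⟨fun t => g * γ t, by simp [h0], fun t ht =>
      HasMFDerivAt.hasMFDerivWithinAt ((hlog t ht).const_mul g)⟩) 1
  exact ⟨δ, hδ0, hδ⟩

variable (G) in
/-- The one-parameter subgroup `t ↦ exp (t X)`. -/
def expCurve (X : E) : ℝ → G := (exists_hasLogDerivAt X).choose

@[simp]
theorem expCurve_zero (X : E) : expCurve G X 0 = 1 := (exists_hasLogDerivAt X).choose_spec.1

theorem hasLogDerivAt_expCurve (X : E) (t : ℝ) : HasLogDerivAt (expCurve G X) X t :=
  (exists_hasLogDerivAt X).choose_spec.2 t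

theorem expCurve_add (X : E) (s t : ℝ) :
    expCurve G X (s + t) = expCurve G X s * expCurve G X t := by
  have h1 : ∀ t, HasLogDerivAt (fun t => expCurve G X (s + t)) X t := fun t => by
    simpa using (hasLogDerivAt_expCurve (G := G) X (s + t)).comp ((hasDerivAt_id t).const_add s)
  exact congrFun (eq_of_hasLogDerivAt h1
    (fun t => (hasLogDerivAt_expCurve X t).const_mul (expCurve G X s)) (by simp)) t

theorem expCurve_neg (X : E) (t : ℝ) : expCurve G X (-t) = (expCurve G X t)⁻¹ := by
  rw [eq_inv_iff_mul_eq_one, ← expCurve_add, neg_add_cancel, expCurve_zero]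

theorem expCurve_smul (X : E) (c t : ℝ) : expCurve G (c • X) t = expCurve G X (c * t) := by
  have h1 : ∀ t, HasLogDerivAt (fun t => expCurve G X (c * t)) (c • X) t := fun t =>
    (hasLogDerivAt_expCurve (G := G) X (c * t)).comp (by simpa using (hasDerivAt_id t).const_mul c)
  exact congrFun (eq_of_hasLogDerivAt (hasLogDerivAt_expCurve _) h1 (by simp)) t

theorem isExp_iff {X : GroupLieAlgebra 𝓘(ℝ, E) G} {g : G} :
    IsExp X g ↔ g = expCurve (E := E) G X 1 := by
  constructor
  · rintro ⟨γ, h0, hγ, rfl⟩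
    rw [isMIntegralCurve_iff_hasLogDerivAt] at hγ
    rw [eq_of_hasLogDerivAt hγ (hasLogDerivAt_expCurve _) (h0.trans (expCurve_zero _).symm)]
  · rintro rfl
    exact ⟨_, expCurve_zero _, isMIntegralCurve_iff_hasLogDerivAt.2 (hasLogDerivAt_expCurve _), rfl⟩

end ExponentialCurves

/-! ### The derivative of the adjoint representation -/

section AdjointDerivative

open Filter Topology

variable {E : Type*} [NormedAddCommGroup E] [NormedSpace ℝ E]
  {G : Type*} [TopologicalSpace G] [ChartedSpace E G] [Group G]

variable (E G) in
/-- The coordinate of the identity in the preferred chart at the identity. -/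
def chartOne : E := extChartAt 𝓘(ℝ, E) (1 : G) 1

variable (E G) in
/-- The group multiplication in the preferred chart at the identity. -/
def chartMul (p : E × E) : E :=
  extChartAt 𝓘(ℝ, E) (1 : G)
    ((extChartAt 𝓘(ℝ, E) (1 : G)).symm p.1 * (extChartAt 𝓘(ℝ, E) (1 : G)).symm p.2)

/-- The derivative at `x` of the preferred chart at the identity. -/
def chartDeriv (x : G) : E →L[ℝ] E :=
  mfderiv 𝓘(ℝ, E) 𝓘(ℝ, E) (extChartAt 𝓘(ℝ, E) (1 : G)) x

theorem symm_chartOne : (extChartAt 𝓘(ℝ, E) (1 : G)).symm (chartOne E G) = 1 :=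
  extChartAt_to_inv _

theorem target_mem_nhds_chartOne :
    (extChartAt 𝓘(ℝ, E) (1 : G)).target ∈ 𝓝 (chartOne E G) :=
  extChartAt_target_mem_nhds _

variable [LieGroup 𝓘(ℝ, E) ∞ G]

theorem isManifold_one : IsManifold 𝓘(ℝ, E) 1 G := IsManifold.of_le (n := ∞) (by simp)

theorem contMDiffAt_symm_chartOne :
    ContMDiffAt 𝓘(ℝ, E) 𝓘(ℝ, E) ∞ (extChartAt 𝓘(ℝ, E) (1 : G)).symm (chartOne E G) :=
  (contMDiffOn_extChartAt_symm (1 : G)).contMDiffAt target_mem_nhds_chartOne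

theorem contDiffAt_chartMul :
    ContDiffAt ℝ ∞ (chartMul E G) (chartOne E G, chartOne E G) := by
  rw [← contMDiffAt_iff_contDiffAt]
  have h1 : ContMDiffAt 𝓘(ℝ, E × E) 𝓘(ℝ, E) ∞
      (fun p : E × E => (extChartAt 𝓘(ℝ, E) (1 : G)).symm p.1) (chartOne E G, chartOne E G) :=
    ContMDiffAt.comp (I' := 𝓘(ℝ, E)) _ (contMDiffAt_symm_chartOne (G := G))
      contDiffAt_fst.contMDiffAt
  have h2 : ContMDiffAt 𝓘(ℝ, E × E) 𝓘(ℝ, E) ∞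
      (fun p : E × E => (extChartAt 𝓘(ℝ, E) (1 : G)).symm p.2) (chartOne E G, chartOne E G) :=
    ContMDiffAt.comp (I' := 𝓘(ℝ, E)) _ (contMDiffAt_symm_chartOne (G := G))
      contDiffAt_snd.contMDiffAt
  refine ContMDiffAt.comp (I' := 𝓘(ℝ, E)) _ ?_ (h1.mul h2)
  simp only [symm_chartOne, mul_one]
  exact contMDiffAt_extChartAt

theorem chartDeriv_one : (chartDeriv (1 : G) : E →L[ℝ] E) = 1 := by
  have := isManifold_one (E := E) (G := G)
  exact mfderiv_extChartAt_self

theorem hasMFDerivAt_chartDeriv {x : G} (hx : x ∈ (extChartAt 𝓘(ℝ, E) (1 : G)).source) :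
    HasMFDerivAt 𝓘(ℝ, E) 𝓘(ℝ, E) (extChartAt 𝓘(ℝ, E) (1 : G)) x (chartDeriv x : E →L[ℝ] E) := by
  have := isManifold_one (E := E) (G := G)
  rw [extChartAt_source] at hx
  exact (mdifferentiableAt_extChartAt hx).hasMFDerivAt

theorem hasMFDerivAt_symm_chartOne :
    HasMFDerivAt 𝓘(ℝ, E) 𝓘(ℝ, E) (extChartAt 𝓘(ℝ, E) (1 : G)).symm (chartOne E G)
      (1 : E →L[ℝ] E) := by
  have := isManifold_one (E := E) (G := G)
  have h := ((contMDiffAt_symm_chartOne (E := E) (G := G)).mdifferentiableAt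
    (by simp)).hasMFDerivAt
  refine h.congr_mfderiv ?_
  have h2 := mfderivWithin_range_extChartAt_symm (I := 𝓘(ℝ, E)) (x := (1 : G))
  rw [modelWithCornersSelf_coe, Set.range_id, mfderivWithin_univ] at h2
  exact h2

theorem eventually_differentiableAt_chartMul :
    ∀ᶠ p in 𝓝 (chartOne E G, chartOne E G), DifferentiableAt ℝ (chartMul E G) p :=
  (((contDiffAt_chartMul (E := E) (G := G)).of_le (m := 1) (by simp)).eventually (by simp)).mono
    fun _ h => h.differentiableAt (by simp)

/-- In the chart, left translations are differentiated by the second partial derivative of the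
multiplication. -/
theorem eventually_fderiv_chartMul_inr :
    ∀ᶠ y in 𝓝 (chartOne E G), ∀ Z : E, fderiv ℝ (chartMul E G) (y, chartOne E G) (0, Z) =
      chartDeriv ((extChartAt 𝓘(ℝ, E) (1 : G)).symm y)
        (leftDeriv ((extChartAt 𝓘(ℝ, E) (1 : G)).symm y) 1 Z) := by
  have hc : Tendsto (fun y => (y, chartOne E G)) (𝓝 (chartOne E G))
      (𝓝 (chartOne E G, chartOne E G)) := (by fun_prop : Continuous _).tendsto' _ _ rfl
  filter_upwards [hc.eventually eventually_differentiableAt_chartMul, target_mem_nhds_chartOne]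
    with y hy hyt Z
  set φ := extChartAt 𝓘(ℝ, E) (1 : G) with hφ
  have h1 : HasFDerivAt (fun w => chartMul E G (y, w))
      (fderiv ℝ (chartMul E G) (y, chartOne E G) ∘L ContinuousLinearMap.inr ℝ E E)
      (chartOne E G) := hy.hasFDerivAt.comp _ (hasFDerivAt_prodMk_right y _)
  have hone : φ.symm (chartOne E G) = 1 := symm_chartOne
  have hm := hasMFDerivAt_mul_left (E := E) (φ.symm y) (φ.symm (chartOne E G))
  have hφy : φ.symm y * φ.symm (chartOne E G) ∈ φ.source := by
    rw [hone, mul_one]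
    exact φ.map_target hyt
  have h2 := HasMFDerivAt.comp (chartOne E G) (hasMFDerivAt_chartDeriv hφy)
    (HasMFDerivAt.comp (chartOne E G) hm hasMFDerivAt_symm_chartOne)
  have h3 : fderiv ℝ (chartMul E G) (y, chartOne E G) ∘L ContinuousLinearMap.inr ℝ E E =
      chartDeriv (φ.symm y * φ.symm (chartOne E G)) ∘L
        leftDeriv (φ.symm y) (φ.symm (chartOne E G)) ∘L 1 := hasMFDerivAt_unique h1.hasMFDerivAt h2
  rw [hone, mul_one] at h3
  exact congr($h3 Z)

/-- In the chart, right translations are differentiated by the first partial derivative of the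
multiplication. -/
theorem eventually_fderiv_chartMul_inl :
    ∀ᶠ y in 𝓝 (chartOne E G), ∀ Z : E, fderiv ℝ (chartMul E G) (chartOne E G, y) (Z, 0) =
      chartDeriv ((extChartAt 𝓘(ℝ, E) (1 : G)).symm y)
        (rightDeriv 1 ((extChartAt 𝓘(ℝ, E) (1 : G)).symm y) Z) := by
  have hc : Tendsto (fun y => (chartOne E G, y)) (𝓝 (chartOne E G))
      (𝓝 (chartOne E G, chartOne E G)) := (by fun_prop : Continuous _).tendsto' _ _ rfl
  filter_upwards [hc.eventually eventually_differentiableAt_chartMul, target_mem_nhds_chartOne]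
    with y hy hyt Z
  set φ := extChartAt 𝓘(ℝ, E) (1 : G) with hφ
  have h1 : HasFDerivAt (fun w => chartMul E G (w, y))
      (fderiv ℝ (chartMul E G) (chartOne E G, y) ∘L ContinuousLinearMap.inl ℝ E E)
      (chartOne E G) :=
    HasFDerivAt.comp (f := fun w => (w, y)) _ hy.hasFDerivAt (hasFDerivAt_prodMk_left _ y)
  have hone : φ.symm (chartOne E G) = 1 := symm_chartOne
  have hm := hasMFDerivAt_mul_right (E := E) (φ.symm (chartOne E G)) (φ.symm y)
  have hφy : φ.symm (chartOne E G) * φ.symm y ∈ φ.source := by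
    rw [hone, one_mul]
    exact φ.map_target hyt
  have h2 := HasMFDerivAt.comp (chartOne E G) (hasMFDerivAt_chartDeriv hφy)
    (HasMFDerivAt.comp (chartOne E G) hm hasMFDerivAt_symm_chartOne)
  have h3 : fderiv ℝ (chartMul E G) (chartOne E G, y) ∘L ContinuousLinearMap.inl ℝ E E =
      chartDeriv (φ.symm (chartOne E G) * φ.symm y) ∘L
        rightDeriv (φ.symm (chartOne E G)) (φ.symm y) ∘L 1 := hasMFDerivAt_unique h1.hasMFDerivAt h2
  rw [hone, one_mul] at h3
  exact congr($h3 Z)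

variable (E G) in
/-- The second derivative at the identity of the multiplication in the chart. -/
def chartMul₂ : E × E →L[ℝ] E × E →L[ℝ] E :=
  fderiv ℝ (fderiv ℝ (chartMul E G)) (chartOne E G, chartOne E G)

theorem chartMul₂_symm (p q : E × E) : chartMul₂ E G p q = chartMul₂ E G q p :=
  (contDiffAt_chartMul (E := E) (G := G)).isSymmSndFDerivAt
    (by rw [minSmoothness_of_isRCLikeNormedField]; exact ENat.LEInfty.out) p q

theorem hasFDerivAt_fderiv_chartMul :
    HasFDerivAt (fderiv ℝ (chartMul E G)) (chartMul₂ E G) (chartOne E G, chartOne E G) :=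
  (((contDiffAt_chartMul (E := E) (G := G)).fderiv_right (m := 1)
    (by rw [one_add_one_eq_two]; exact ENat.LEInfty.out)).differentiableAt (by simp)).hasFDerivAt

/-- The left invariant vector field of `Z` in the chart at the identity. -/
theorem mpullbackWithin_mulInvariantVectorField_eventuallyEq
    (Z : GroupLieAlgebra 𝓘(ℝ, E) G) :
    VectorField.mpullbackWithin 𝓘(ℝ, E) 𝓘(ℝ, E) (extChartAt 𝓘(ℝ, E) (1 : G)).symm
      (mulInvariantVectorField Z) Set.univ =ᶠ[𝓝 (chartOne E G)]
      fun y => (fderiv ℝ (chartMul E G) (y, chartOne E G) (0, Z) : E) := by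
  have := isManifold_one (E := E) (G := G)
  filter_upwards [eventually_fderiv_chartMul_inr (E := E) (G := G), target_mem_nhds_chartOne]
    with y hy hyt
  refine Eq.trans ?_ (hy Z).symm
  have h1 := mfderiv_extChartAt_comp_mfderivWithin_extChartAt_symm hyt
  have h2 := mfderivWithin_extChartAt_symm_comp_mfderiv_extChartAt hyt
  rw [modelWithCornersSelf_coe, Set.range_id] at h1 h2
  exact congr($(ContinuousLinearMap.inverse_eq h2 h1) (mulInvariantVectorField Z _))

theorem hasFDerivAt_fderiv_chartMul_inr (Z : E) :
    HasFDerivAt (fun y => fderiv ℝ (chartMul E G) (y, chartOne E G) (0, Z))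
      ((ContinuousLinearMap.apply ℝ E ((0 : E), Z)) ∘L chartMul₂ E G ∘L
        ContinuousLinearMap.inl ℝ E E) (chartOne E G) :=
  (ContinuousLinearMap.apply ℝ E ((0 : E), Z)).hasFDerivAt.comp _
    (hasFDerivAt_fderiv_chartMul.comp (chartOne E G) (hasFDerivAt_prodMk_left _ _))

theorem fderiv_chartMul_inr_chartOne (Z : E) :
    fderiv ℝ (chartMul E G) (chartOne E G, chartOne E G) (0, Z) = Z := by
  have h := (eventually_fderiv_chartMul_inr (E := E) (G := G)).self_of_nhds Z
  rw [symm_chartOne, leftDeriv_one, chartDeriv_one] at h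
  exact h

theorem fderiv_chartMul_inl_chartOne (Z : E) :
    fderiv ℝ (chartMul E G) (chartOne E G, chartOne E G) (Z, 0) = Z := by
  have h := (eventually_fderiv_chartMul_inl (E := E) (G := G)).self_of_nhds Z
  rw [symm_chartOne, rightDeriv_one, chartDeriv_one] at h
  exact h

theorem lieBracket_fderiv_chartMul_inr (X Z : E) :
    VectorField.lieBracket ℝ (fun y => fderiv ℝ (chartMul E G) (y, chartOne E G) (0, X))
      (fun y => fderiv ℝ (chartMul E G) (y, chartOne E G) (0, Z)) (chartOne E G) =
      chartMul₂ E G (X, 0) (0, Z) - chartMul₂ E G (Z, 0) (0, X) := by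
  rw [VectorField.lieBracket_eq]
  simp only [fderiv_chartMul_inr_chartOne, (hasFDerivAt_fderiv_chartMul_inr _).fderiv]
  rfl

variable (G) in
/-- The bracket of the Lie algebra of `G`, as an operation on the model space. -/
def modelBracket [CompleteSpace E] (X Z : E) : E :=
  Bracket.bracket (L := GroupLieAlgebra 𝓘(ℝ, E) G) (M := GroupLieAlgebra 𝓘(ℝ, E) G) X Z

/-- The bracket is the skew-symmetrized mixed second derivative of the multiplication. -/
theorem bracket_eq_chartMul₂ [CompleteSpace E] (X Z : E) :
    modelBracket G X Z = chartMul₂ E G (X, 0) (0, Z) - chartMul₂ E G (Z, 0) (0, X) := by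
  have := isManifold_one (E := E) (G := G)
  have h0 : (mfderiv 𝓘(ℝ, E) 𝓘(ℝ, E) (extChartAt 𝓘(ℝ, E) (1 : G)) 1).inverse =
      ContinuousLinearMap.id ℝ E := by
    rw [mfderiv_extChartAt_self]
    exact ContinuousLinearMap.inverse_id
  have h1 := mpullbackWithin_mulInvariantVectorField_eventuallyEq (G := G) X
  have h2 := mpullbackWithin_mulInvariantVectorField_eventuallyEq (G := G) Z
  have h3 := h1.lieBracket_vectorField_eq (𝕜 := ℝ) h2
  have h4 := VectorField.mlieBracketWithin_apply (I := 𝓘(ℝ, E)) (V := mulInvariantVectorField X)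
    (W := mulInvariantVectorField Z) (s := Set.univ) (x₀ := (1 : G))
  rw [modelWithCornersSelf_coe, Set.range_id, Set.preimage_univ, Set.univ_inter] at h4
  refine h4.trans ((congr($h0 _)).trans ?_)
  exact (congrFun (VectorField.lieBracketWithin_univ (𝕜 := ℝ) (E := E)) (chartOne E G)).trans
    (h3.trans (lieBracket_fderiv_chartMul_inr X Z))

/-- Conjugation is determined by `g X = (Ad g X) g`. -/
theorem leftDeriv_eq_rightDeriv_comp_adjointCLM (g : G) :
    (leftDeriv g 1 : E →L[ℝ] E) = rightDeriv 1 g ∘L adjointCLM g := by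
  have h := rightDeriv_comp_rightDeriv (E := E) g g⁻¹ g
  rw [mul_inv_cancel, inv_mul_cancel, rightDeriv_one] at h
  rw [adjointCLM_eq, ← ContinuousLinearMap.comp_assoc, h]
  rfl

/-- In the chart, `Ad` is differentiable at the identity with derivative the bracket: differentiate
the identity `g X = (Ad g X) g`. -/
theorem hasFDerivAt_adjointCLM_symm [CompleteSpace E] (X Z : E) :
    ∃ c' : E →L[ℝ] E, HasFDerivAt
      (fun y => adjointCLM ((extChartAt 𝓘(ℝ, E) (1 : G)).symm y) Z) c' (chartOne E G) ∧
      c' X = modelBracket G X Z := by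
  -- In the chart, the identity reads `A y (c y) = V y`.
  let A : E → E →L[ℝ] E := fun y =>
    fderiv ℝ (chartMul E G) (chartOne E G, y) ∘L ContinuousLinearMap.inl ℝ E E
  let V : E → E := fun y => fderiv ℝ (chartMul E G) (y, chartOne E G) (0, Z)
  let c : E → E := fun y => adjointCLM ((extChartAt 𝓘(ℝ, E) (1 : G)).symm y) Z
  have hA : HasFDerivAt A
      ((ContinuousLinearMap.compL ℝ E (E × E) E).flip (ContinuousLinearMap.inl ℝ E E) ∘L
        chartMul₂ E G ∘L ContinuousLinearMap.inr ℝ E E) (chartOne E G) :=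
    ((ContinuousLinearMap.compL ℝ E (E × E) E).flip
      (ContinuousLinearMap.inl ℝ E E)).hasFDerivAt.comp _
      (hasFDerivAt_fderiv_chartMul.comp (chartOne E G) (hasFDerivAt_prodMk_right _ _))
  have hA1 : A (chartOne E G) = ContinuousLinearEquiv.refl ℝ E := by
    ext Y
    exact fderiv_chartMul_inl_chartOne Y
  have hAc : ∀ᶠ y in 𝓝 (chartOne E G), A y (c y) = V y := by
    filter_upwards [eventually_fderiv_chartMul_inr (E := E) (G := G),
      eventually_fderiv_chartMul_inl (E := E) (G := G)] with y h1 h2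
    refine (h2 _).trans (Eq.trans ?_ (h1 Z).symm)
    rw [leftDeriv_eq_rightDeriv_comp_adjointCLM]
    rfl
  -- Differentiability of `c` follows by inverting `A`, which is invertible near the identity.
  have hinv : ∀ᶠ y in 𝓝 (chartOne E G), (A y).inverse (V y) = c y := by
    have hopen : ∀ᶠ y in 𝓝 (chartOne E G), A y ∈ Set.range ((↑) : (E ≃L[ℝ] E) → E →L[ℝ] E) :=
      hA.continuousAt.eventually ((ContinuousLinearEquiv.isOpen).mem_nhds
        ⟨ContinuousLinearEquiv.refl ℝ E, hA1.symm⟩)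
    filter_upwards [hAc, hopen] with y h1 h2
    obtain ⟨e, he⟩ := h2
    rw [← h1, ← he, ContinuousLinearMap.inverse_equiv]
    exact e.symm_apply_apply _
  have hV : HasFDerivAt V _ (chartOne E G) := hasFDerivAt_fderiv_chartMul_inr Z
  have hd : DifferentiableAt ℝ c (chartOne E G) := by
    have h1 : DifferentiableAt ℝ (fun y => (A y).inverse) (chartOne E G) := by
      refine DifferentiableAt.comp (g := ContinuousLinearMap.inverse) _ ?_ hA.differentiableAt
      rw [hA1]
      exact (contDiffAt_map_inverse (n := 1) (ContinuousLinearEquiv.refl ℝ E)).differentiableAt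
        (by simp)
    exact (h1.clm_apply hV.differentiableAt).congr_of_eventuallyEq
      (hinv.mono fun y h => h.symm)
  refine ⟨_, hd.hasFDerivAt, ?_⟩
  have h1 := (hA.clm_apply hd.hasFDerivAt).congr_of_eventuallyEq (hAc.mono fun y h => h.symm)
  have h2 := congr($(h1.unique hV) X)
  have hc1 : c (chartOne E G) = Z := by
    simp only [c, symm_chartOne, adjointCLM_one]
    rfl
  rw [hA1, hc1] at h2
  change fderiv ℝ c (chartOne E G) X + chartMul₂ E G (0, X) (Z, 0) =
    chartMul₂ E G (X, 0) (0, Z) at h2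
  rw [bracket_eq_chartMul₂, chartMul₂_symm (Z, 0), ← h2, add_sub_cancel_right]

theorem hasDerivAt_adjointCLM_zero [CompleteSpace E] {γ : ℝ → G} {X : E}
    (h0 : γ 0 = 1) (hγ : HasLogDerivAt γ X 0) (Z : E) :
    HasDerivAt (fun t => adjointCLM (γ t) Z) (modelBracket G X Z) 0 := by
  obtain ⟨c', hc, hc'⟩ := hasFDerivAt_adjointCLM_symm (G := G) X Z
  have hs : γ 0 ∈ (extChartAt 𝓘(ℝ, E) (1 : G)).source := h0 ▸ mem_extChartAt_source _
  have h1 : HasFDerivAt (extChartAt 𝓘(ℝ, E) (1 : G) ∘ γ) (chartDeriv (γ 0) ∘L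
      ((1 : ℝ →L[ℝ] ℝ).smulRight (leftDeriv (γ 0) 1 X) : ℝ →L[ℝ] E)) 0 :=
    (HasMFDerivAt.comp 0 (hasMFDerivAt_chartDeriv hs) hγ).hasFDerivAt
  have h2 : HasDerivAt (extChartAt 𝓘(ℝ, E) (1 : G) ∘ γ) X 0 := by
    refine h1.hasDerivAt.congr_deriv ?_
    rw [h0, chartDeriv_one, leftDeriv_one]
    change (1 : ℝ) • X = X
    rw [one_smul]
  have h3 : (extChartAt 𝓘(ℝ, E) (1 : G) ∘ γ) 0 = chartOne E G := by
    rw [Function.comp_apply, h0]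
    rfl
  rw [← h3] at hc
  rw [← hc']
  refine (hc.comp_hasDerivAt 0 h2).congr_of_eventuallyEq ?_
  have hγc : ContinuousAt γ 0 := hγ.continuousAt
  filter_upwards [hγc.eventually (extChartAt_source_mem_nhds' hs)] with t ht
  rw [Function.comp_apply, Function.comp_apply, (extChartAt 𝓘(ℝ, E) (1 : G)).left_inv ht]

end AdjointDerivative

/-! ### The adjoint action of one-parameter subgroups -/

section AdjointExp

variable {E : Type*} [NormedAddCommGroup E] [NormedSpace ℝ E] [CompleteSpace E]
  {G : Type*} [TopologicalSpace G] [ChartedSpace E G] [Group G] [LieGroup 𝓘(ℝ, E) ∞ G]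

variable (G) in
/-- The operator `ad X`, on the model space. -/
def modelAd (X : E) : E →ₗ[ℝ] E where
  toFun Z := modelBracket G X Z
  map_add' Y Z := lie_add (L := GroupLieAlgebra 𝓘(ℝ, E) G) (M := GroupLieAlgebra 𝓘(ℝ, E) G) X Y Z
  map_smul' c Z :=
    lie_smul (L := GroupLieAlgebra 𝓘(ℝ, E) G) (M := GroupLieAlgebra 𝓘(ℝ, E) G) c X Z

variable [T2Space G]

theorem hasDerivAt_adjointCLM_expCurve (X Z : E) (t : ℝ) :
    HasDerivAt (fun t => adjointCLM (expCurve G X t) Z)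
      (modelBracket G X (adjointCLM (expCurve G X t) Z)) t := by
  have h1 := hasDerivAt_adjointCLM_zero (expCurve_zero X) (hasLogDerivAt_expCurve (G := G) X 0)
    (adjointCLM (expCurve G X t) Z)
  rw [← sub_self t] at h1
  refine (h1.comp_sub_const t t).congr_of_eventuallyEq (Filter.Eventually.of_forall fun s => ?_)
  change adjointCLM (expCurve G X s) Z =
    (adjointCLM (expCurve G X (s - t)) ∘L adjointCLM (expCurve G X t)) Z
  rw [← adjointCLM_mul, ← expCurve_add, sub_add_cancel]

/-- `Ad (exp (t X))` is the flow of the linear vector field `ad X`. -/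
theorem adjointCLM_expCurve_eq [FiniteDimensional ℝ E] {X : E} {c : ℝ → E}
    (hc : ∀ t, HasDerivAt c (modelBracket G X (c t)) t) (t : ℝ) :
    adjointCLM (expCurve G X t) (c 0) = c t := by
  have h1 := eq_exp_smul_apply_of_hasDerivAt (modelAd G X).toContinuousLinearMap
    (hasDerivAt_adjointCLM_expCurve X (c 0)) t
  have h2 := eq_exp_smul_apply_of_hasDerivAt (modelAd G X).toContinuousLinearMap hc t
  rw [expCurve_zero, adjointCLM_one] at h1
  exact h1.trans h2.symm

/-- If `g` commutes with the one-parameter group of `X`, then `Ad g` fixes `X`. -/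
theorem adjointCLM_eq_self_of_commute {g : G} {X : E}
    (h : ∀ t, g * expCurve G X t = expCurve G X t * g) : adjointCLM g X = X := by
  have h1 := (hasLogDerivAt_expCurve (G := G) X 0).const_mul g
  have h2 := (hasLogDerivAt_expCurve (G := G) X 0).mul (hasLogDerivAt_const g 0)
  have h3 : (fun t => g * expCurve G X t) = fun t => expCurve G X t * g := funext h
  rw [h3] at h1
  have h4 : leftDeriv (expCurve G X 0 * g) 1 X =
      leftDeriv (expCurve G X 0 * g) 1 (adjointCLM g⁻¹ X + 0) := by
    have h5 := congr($(hasMFDerivAt_unique h1 h2) (1 : ℝ))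
    change (1 : ℝ) • leftDeriv (expCurve G X 0 * g) 1 X =
      (1 : ℝ) • leftDeriv (expCurve G X 0 * g) 1 (adjointCLM g⁻¹ X + 0) at h5
    rwa [one_smul, one_smul] at h5
  rw [expCurve_zero, one_mul, add_zero] at h4
  have h5 := congrArg (leftDeriv (E := E) g⁻¹ g) h4
  have h6 := leftDeriv_comp_leftDeriv (E := E) g⁻¹ g 1
  rw [mul_one, inv_mul_cancel, leftDeriv_one] at h6
  rw [← ContinuousLinearMap.comp_apply, ← ContinuousLinearMap.comp_apply, h6] at h5
  change X = adjointCLM g⁻¹ X at h5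
  have h7 := adjointCLM_inv_apply_adjointCLM (E := E) g⁻¹ X
  rwa [← h5, inv_inv] at h7

end AdjointExp

/-! ### The adjoint action on an `sl₂`-triple -/

section Sl2Adjoint

theorem IsSl2Triple.lie_combination {L : Type*} [LieRing L] [LieAlgebra ℝ L] {h e f : L}
    (t : IsSl2Triple h e f) (x y z x' y' z' : ℝ) :
    ⁅x • e + y • f + z • h, x' • e + y' • f + z' • h⁆ =
      (2 * (z * x' - x * z')) • e + (2 * (y * z' - z * y')) • f + (x * y' - y * x') • h := by
  have h1 : ⁅f, e⁆ = -h := by rw [← lie_skew, t.lie_e_f]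
  have h2 : ⁅e, h⁆ = -((2 : ℝ) • e) := by rw [← lie_skew, t.lie_h_e_smul ℝ]
  have h3 : ⁅f, h⁆ = (2 : ℝ) • f := by rw [← lie_skew, t.lie_lie_smul_f ℝ, neg_neg]
  simp only [lie_add, add_lie, lie_smul, smul_lie, lie_self, t.lie_e_f,
    t.lie_h_e_smul ℝ, t.lie_lie_smul_f ℝ, h1, h2, h3]
  module

variable {E : Type*} [NormedAddCommGroup E] [NormedSpace ℝ E] [FiniteDimensional ℝ E]
  [CompleteSpace E]
  {G : Type*} [TopologicalSpace G] [ChartedSpace E G] [Group G] [LieGroup 𝓘(ℝ, E) ∞ G]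
  [T2Space G] {h e f : E} (ht : IsSl2Triple (L := GroupLieAlgebra 𝓘(ℝ, E) G) h e f)
include ht

/-- `Ad` of the one-parameter group of an element of the span of an `sl₂`-triple, computed by
solving its linear differential equation in coordinates. -/
theorem adjointCLM_expCurve_combination (p q r : ℝ) {x y z x' y' z' : ℝ → ℝ}
    (hx : ∀ t, HasDerivAt x (x' t) t) (hy : ∀ t, HasDerivAt y (y' t) t)
    (hz : ∀ t, HasDerivAt z (z' t) t) (hx' : ∀ t, x' t = 2 * (p * x t - q * z t))
    (hy' : ∀ t, y' t = 2 * (r * z t - p * y t)) (hz' : ∀ t, z' t = q * y t - r * x t) (t : ℝ) :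
    adjointCLM (expCurve G (q • e + r • f + p • h) t) (x 0 • e + y 0 • f + z 0 • h) =
      x t • e + y t • f + z t • h := by
  refine adjointCLM_expCurve_eq (c := fun t => x t • e + y t • f + z t • h) (fun t => ?_) t
  have h1 : modelBracket G (q • e + r • f + p • h) (x t • e + y t • f + z t • h) =
      (2 * (p * x t - q * z t)) • e + (2 * (r * z t - p * y t)) • f + (q * y t - r * x t) • h :=
    ht.lie_combination q r p (x t) (y t) (z t)
  rw [h1, ← hx', ← hy', ← hz']
  exact (((hx t).smul_const e).add ((hy t).smul_const f)).add ((hz t).smul_const h)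

theorem adjointCLM_expCurve_e (x y z t : ℝ) :
    adjointCLM (expCurve G e t) (x • e + y • f + z • h) =
      (x - 2 * z * t - y * t ^ 2) • e + y • f + (z + y * t) • h := by
  have h1 := adjointCLM_expCurve_combination ht 0 1 0
    (x := fun t => x - 2 * z * t - y * t ^ 2) (y := fun _ => y) (z := fun t => z + y * t)
    (x' := fun t => -(2 * z) - y * (2 * t)) (y' := fun _ => 0) (z' := fun _ => y)
    (fun t => ((((hasDerivAt_id t).const_mul (2 * z)).const_sub x).sub
      ((hasDerivAt_pow 2 t).const_mul y)).congr_deriv (by simp))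
    (fun t => hasDerivAt_const _ _)
    (fun t => by simpa using ((hasDerivAt_id t).const_mul y).const_add z)
    (fun t => by ring) (fun t => by ring) (fun t => by ring) t
  simpa using h1

theorem adjointCLM_expCurve_h (x y z t : ℝ) :
    adjointCLM (expCurve G h t) (x • e + y • f + z • h) =
      (x * Real.exp (2 * t)) • e + (y * Real.exp (-2 * t)) • f + z • h := by
  have hexp : ∀ a t : ℝ, HasDerivAt (fun t => Real.exp (a * t)) (Real.exp (a * t) * a) t :=
    fun a t => by simpa using ((hasDerivAt_id t).const_mul a).exp
  have h1 := adjointCLM_expCurve_combination ht 1 0 0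
    (x := fun t => x * Real.exp (2 * t)) (y := fun t => y * Real.exp (-2 * t)) (z := fun _ => z)
    (x' := fun t => x * (Real.exp (2 * t) * 2)) (y' := fun t => y * (Real.exp (-2 * t) * -2))
    (z' := fun _ => 0)
    (fun t => (hexp 2 t).const_mul x) (fun t => (hexp (-2) t).const_mul y)
    (fun t => hasDerivAt_const _ _)
    (fun t => by ring) (fun t => by ring) (fun t => by ring) t
  simpa using h1

theorem adjointCLM_expCurve_sub_e (t : ℝ) :
    adjointCLM (expCurve G (f - e) t) e =
      (Real.cos t ^ 2) • e + (-Real.sin t ^ 2) • f + (-(Real.cos t * Real.sin t)) • h := by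
  have h1 := adjointCLM_expCurve_combination ht 0 (-1) 1
    (x := fun t => Real.cos t ^ 2) (y := fun t => -Real.sin t ^ 2)
    (z := fun t => -(Real.cos t * Real.sin t))
    (x' := fun t => 2 * Real.cos t * -Real.sin t) (y' := fun t => -(2 * Real.sin t * Real.cos t))
    (z' := fun t => -(-Real.sin t * Real.sin t + Real.cos t * Real.cos t))
    (fun t => ((Real.hasDerivAt_cos t).pow 2).congr_deriv (by simp))
    (fun t => ((Real.hasDerivAt_sin t).pow 2).neg.congr_deriv (by simp))
    (fun t => ((Real.hasDerivAt_cos t).mul (Real.hasDerivAt_sin t)).neg)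
    (fun t => by ring) (fun t => by ring) (fun t => by ring) t
  have h2 : (-1 : ℝ) • e + (1 : ℝ) • f + (0 : ℝ) • h = f - e := by module
  rw [h2] at h1
  simpa using h1

theorem adjointCLM_expCurve_sub_h (t : ℝ) :
    adjointCLM (expCurve G (f - e) t) h =
      (2 * (Real.cos t * Real.sin t)) • e + (2 * (Real.cos t * Real.sin t)) • f +
        (Real.cos t ^ 2 - Real.sin t ^ 2) • h := by
  have h1 := adjointCLM_expCurve_combination ht 0 (-1) 1
    (x := fun t => 2 * (Real.cos t * Real.sin t)) (y := fun t => 2 * (Real.cos t * Real.sin t))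
    (z := fun t => Real.cos t ^ 2 - Real.sin t ^ 2)
    (x' := fun t => 2 * (-Real.sin t * Real.sin t + Real.cos t * Real.cos t))
    (y' := fun t => 2 * (-Real.sin t * Real.sin t + Real.cos t * Real.cos t))
    (z' := fun t => 2 * Real.cos t * -Real.sin t - 2 * Real.sin t * Real.cos t)
    (fun t => ((Real.hasDerivAt_cos t).mul (Real.hasDerivAt_sin t)).const_mul 2)
    (fun t => ((Real.hasDerivAt_cos t).mul (Real.hasDerivAt_sin t)).const_mul 2)
    (fun t => (((Real.hasDerivAt_cos t).pow 2).sub ((Real.hasDerivAt_sin t).pow 2)).congr_deriv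
      (by simp))
    (fun t => by ring) (fun t => by ring) (fun t => by ring) t
  have h2 : (-1 : ℝ) • e + (1 : ℝ) • f + (0 : ℝ) • h = f - e := by module
  rw [h2] at h1
  simpa using h1

end Sl2Adjoint

/-! ### Iwasawa coordinates -/

section IwasawaCoordinates

/-- A row vector moved by the one-parameter group of the matrix `(p, q; r, -p)`. -/
theorem exists_row_hasDerivAt (p q r x₀ y₀ : ℝ) : ∃ x y : ℝ → ℝ, x 0 = x₀ ∧ y 0 = y₀ ∧
    ∀ t, HasDerivAt x (p * x t + r * y t) t ∧ HasDerivAt y (q * x t - p * y t) t := by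
  let D : ℝ × ℝ →L[ℝ] ℝ × ℝ :=
    (p • ContinuousLinearMap.fst ℝ ℝ ℝ + r • ContinuousLinearMap.snd ℝ ℝ ℝ).prod
      (q • ContinuousLinearMap.fst ℝ ℝ ℝ - p • ContinuousLinearMap.snd ℝ ℝ ℝ)
  let v : ℝ → ℝ × ℝ := fun t => NormedSpace.exp (t • D) (x₀, y₀)
  have hv : ∀ t, HasDerivAt v (D (v t)) t := fun t => by
    simpa using (hasDerivAt_exp_smul_const' (𝕂 := ℝ) D t).clm_apply (hasDerivAt_const t (x₀, y₀))
  have hv0 : v 0 = (x₀, y₀) := by simp [v]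
  exact ⟨fun t => (v t).1, fun t => (v t).2, by simp [hv0], by simp [hv0],
    fun t => ⟨(hv t).fst, (hv t).snd⟩⟩

/-- The differential equation for the Iwasawa coordinates `(k, s, u)` of a curve in `SL(2, ℝ)` with
logarithmic derivative `(p, q; r, -p)` has global solutions. They are read off from the matrix
`(a, b; c, d)` solving the linear equation: `e^{2s} = a² + c²`, `u = (ab + cd) / (a² + c²)`, and `k`
is the polar angle of the first column, obtained by integrating its derivative. -/
theorem exists_iwasawa_coordinates (p q r k₀ s₀ u₀ : ℝ) : ∃ k s u : ℝ → ℝ,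
    k 0 = k₀ ∧ s 0 = s₀ ∧ u 0 = u₀ ∧ ∀ t,
      HasDerivAt k (r * Real.exp (-2 * s t)) t ∧
      HasDerivAt s (p + r * u t) t ∧
      HasDerivAt u (q - 2 * p * u t - r * u t ^ 2 + r * Real.exp (-2 * s t) ^ 2) t := by
  obtain ⟨a, b, ha0, hb0, hab⟩ := exists_row_hasDerivAt p q r (Real.exp s₀) (Real.exp s₀ * u₀)
  obtain ⟨c, d, hc0, hd0, hcd⟩ := exists_row_hasDerivAt p q r 0 (Real.exp (-s₀))
  have hdet : ∀ t, a t * d t - b t * c t = 1 := by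
    have h1 : ∀ t, HasDerivAt (fun t => a t * d t - b t * c t) 0 t := fun t =>
      (((hab t).1.mul (hcd t).2).sub ((hab t).2.mul (hcd t).1)).congr_deriv (by ring)
    intro t
    have h2 := is_const_of_deriv_eq_zero (fun t => (h1 t).differentiableAt)
      (fun t => (h1 t).deriv) t 0
    simp only [ha0, hb0, hc0, hd0, ← Real.exp_add] at h2
    simpa using h2
  let ρ : ℝ → ℝ := fun t => a t ^ 2 + c t ^ 2
  let σ : ℝ → ℝ := fun t => a t * b t + c t * d t
  have hρ : ∀ t, 0 < ρ t := fun t => by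
    have h1 : a t ≠ 0 ∨ c t ≠ 0 := by
      by_contra! h2
      have h3 := hdet t
      simp [h2.1, h2.2] at h3
    rcases h1 with h1 | h1
    · have : 0 < a t ^ 2 := by positivity
      exact add_pos_of_pos_of_nonneg this (sq_nonneg _)
    · have : 0 < c t ^ 2 := by positivity
      exact add_pos_of_nonneg_of_pos (sq_nonneg _) this
  have hρ' : ∀ t, HasDerivAt ρ (2 * p * ρ t + 2 * r * σ t) t := fun t =>
    (((hab t).1.pow 2).add ((hcd t).1.pow 2)).congr_deriv (by simp [ρ, σ]; ring)
  have hσ' : ∀ t, HasDerivAt σ (q * ρ t + r * (b t ^ 2 + d t ^ 2)) t := fun t =>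
    (((hab t).1.mul (hab t).2).add ((hcd t).1.mul (hcd t).2)).congr_deriv (by simp [ρ]; ring)
  -- Lagrange's identity for the columns of a matrix of determinant one.
  have hrel : ∀ t, ρ t * (b t ^ 2 + d t ^ 2) = 1 + σ t ^ 2 := fun t => by
    simp only [ρ, σ]
    linear_combination (a t * d t - b t * c t + 1) * hdet t
  let s : ℝ → ℝ := fun t => Real.log (ρ t) / 2
  have hs : ∀ t, Real.exp (-2 * s t) = (ρ t)⁻¹ := fun t => by
    rw [show -2 * s t = -Real.log (ρ t) by simp only [s]; ring, Real.exp_neg, Real.exp_log (hρ t)]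
  have hs' : ∀ t, HasDerivAt s (p + r * (σ t / ρ t)) t := fun t => by
    refine (((hρ' t).log (hρ t).ne').div_const 2).congr_deriv ?_
    have := (hρ t).ne'
    field_simp
  have hcont : Continuous fun t => r * Real.exp (-2 * s t) := by
    have : Continuous s := continuous_iff_continuousAt.2 fun t => (hs' t).continuousAt
    fun_prop
  refine ⟨fun t => k₀ + ∫ τ in (0 : ℝ)..t, r * Real.exp (-2 * s τ), s, fun t => σ t / ρ t,
    by simp, ?_, ?_, fun t => ⟨?_, hs' t, ?_⟩⟩
  · simp only [s, ρ, ha0, hc0]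
    rw [← Real.exp_nat_mul]
    simp
  · simp only [σ, ρ, ha0, hb0, hc0]
    have := Real.exp_pos s₀
    field_simp
    ring
  · exact (hcont.integral_hasStrictDerivAt 0 t).hasDerivAt.const_add k₀
  · refine ((hσ' t).div (hρ' t) (hρ t).ne').congr_deriv ?_
    rw [hs]
    have := (hρ t).ne'
    field_simp
    linear_combination r * hrel t

end IwasawaCoordinates

/-! ### The Iwasawa decomposition of the subgroup of an `sl₂`-triple -/

section Iwasawa

theorem IsSl2Triple.coord_eq_zero {L : Type*} [LieRing L] [LieAlgebra ℝ L] {h e f : L}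
    (t : IsSl2Triple h e f) {x y z : ℝ} (h0 : x • e + y • f + z • h = 0) :
    x = 0 ∧ y = 0 ∧ z = 0 := by
  have h1 := t.eq_zero_of_sl2Map_eq_zero (M := !![z, x; y, -z]) (by
    simpa [sl2Map_apply] using h0)
  refine ⟨by simpa using h1.1, by simpa using h1.2.1, ?_⟩
  simpa using h1.2.2

variable {E : Type*} [NormedAddCommGroup E] [NormedSpace ℝ E] [FiniteDimensional ℝ E]
  [CompleteSpace E]
  {G : Type*} [TopologicalSpace G] [ChartedSpace E G] [Group G] [LieGroup 𝓘(ℝ, E) ∞ G]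
  [T2Space G] {h e f : E} (ht : IsSl2Triple (L := GroupLieAlgebra 𝓘(ℝ, E) G) h e f)
include ht

/-- The set `K A N`, with `K`, `A`, `N` the one-parameter groups of `f - e`, `h` and `e`, is stable
under right multiplication by exponentials of the span of the `sl₂`-triple. -/
theorem exists_iwasawa_mul_expCurve (k₀ s₀ u₀ p q r : ℝ) : ∃ k s u : ℝ,
    expCurve G (f - e) k₀ * expCurve G h s₀ * expCurve G e u₀ *
        expCurve G (q • e + r • f + p • h) 1 =
      expCurve G (f - e) k * expCurve G h s * expCurve G e u := by
  -- Both sides of the claim are the values at `1` of curves with the same logarithmic derivative.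
  obtain ⟨k, s, u, hk0, hs0, hu0, hksu⟩ := exists_iwasawa_coordinates p q r k₀ s₀ u₀
  refine ⟨k 1, s 1, u 1, ?_⟩
  have h1 : ∀ t, HasLogDerivAt
      (fun t => expCurve G (f - e) (k t) * expCurve G h (s t) * expCurve G e (u t))
      (q • e + r • f + p • h) t := by
    intro t
    obtain ⟨hk, hs, hu⟩ := hksu t
    have h2 := (((hasLogDerivAt_expCurve (G := G) (f - e) (k t)).comp hk).mul
      ((hasLogDerivAt_expCurve (G := G) h (s t)).comp hs)).mul
      ((hasLogDerivAt_expCurve (G := G) e (u t)).comp hu)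
    convert h2 using 1
    rw [← expCurve_neg, ← expCurve_neg]
    set ε := Real.exp (-2 * s t) with hε
    have h3 : (r * ε) • (f - e) = (-(r * ε)) • e + (r * ε) • f + (0 : ℝ) • h := by module
    have h4 : Real.exp (2 * -s t) = ε := by rw [hε]; congr 1; ring
    have h5 : ε * Real.exp (-2 * -s t) = 1 := by
      rw [hε, ← Real.exp_add]
      simp
    have h6 : r * ε * Real.exp (-2 * -s t) = r := by rw [mul_assoc, h5, mul_one]
    have h7 : (-(r * ε) * ε) • e + r • f + (0 : ℝ) • h + (p + r * u t) • h =
        (-(r * ε) * ε) • e + r • f + (p + r * u t) • h := by module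
    rw [h3, adjointCLM_expCurve_h ht, h4, h6, h7, adjointCLM_expCurve_e ht]
    module
  have h2 := eq_of_hasLogDerivAt (fun t => (hasLogDerivAt_expCurve (G := G)
    (q • e + r • f + p • h) t).const_mul
      (expCurve G (f - e) k₀ * expCurve G h s₀ * expCurve G e u₀)) h1
    (by simp [hk0, hs0, hu0])
  exact congrFun h2 1

/-- The Iwasawa decomposition of the connected subgroup of an `sl₂`-triple. -/
theorem exists_iwasawa {S : Set (GroupLieAlgebra 𝓘(ℝ, E) G)}
    (hS : ∀ X ∈ S, ∃ q r p : ℝ, X = (q • e + r • f + p • h : E)) {g : G}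
    (hg : g ∈ expSubgroup S) : ∃ k s u : ℝ,
      g = expCurve G (f - e) k * expCurve G h s * expCurve G e u := by
  induction hg using Subgroup.closure_induction_right with
  | one => exact ⟨0, 0, 0, by simp⟩
  | mul_right x _ y hy ih =>
    obtain ⟨k, s, u, rfl⟩ := ih
    obtain ⟨X, hX, hy⟩ := hy
    obtain ⟨q, r, p, rfl⟩ := hS X hX
    rw [isExp_iff.1 hy]
    exact exists_iwasawa_mul_expCurve ht k s u p q r
  | mul_inv_cancel x _ y hy ih =>
    obtain ⟨k, s, u, rfl⟩ := ih
    obtain ⟨X, hX, hy⟩ := hy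
    obtain ⟨q, r, p, rfl⟩ := hS X hX
    have h1 : -(1 : ℝ) = (-1) * 1 := by norm_num
    rw [isExp_iff.1 hy, ← expCurve_neg, h1, ← expCurve_smul, show
      (-1 : ℝ) • (q • e + r • f + p • h) = (-q) • e + (-r) • f + (-p) • h by module]
    exact exists_iwasawa_mul_expCurve ht k s u (-p) (-q) (-r)

/-- An element `k a n` that acts trivially on `h` and `e` lies in `K`: since `Ad (k a n) e` and
`Ad (k a n) h` are explicit, `a` and `n` are trivial. -/
theorem iwasawa_eq_of_adjointCLM_eq {k s u : ℝ}
    (he : adjointCLM (expCurve G (f - e) k * expCurve G h s * expCurve G e u) e = e)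
    (hh : adjointCLM (expCurve G (f - e) k * expCurve G h s * expCurve G e u) h = h) :
    expCurve G (f - e) k * expCurve G h s * expCurve G e u = expCurve G (f - e) k := by
  have hn := adjointCLM_expCurve_e ht
  have ha := adjointCLM_expCurve_h ht
  have hn1 : adjointCLM (expCurve G e u) e = e := by simpa using hn 1 0 0 u
  have ha1 : adjointCLM (expCurve G h s) e = Real.exp (2 * s) • e := by simpa using ha 1 0 0 s
  have hn2 : adjointCLM (expCurve G e u) h = (-(2 * u)) • e + h := by
    simpa using hn 0 0 1 u
  have ha2 : adjointCLM (expCurve G h s) h = h := by simpa using ha 0 0 1 s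
  rw [adjointCLM_mul, adjointCLM_mul, ContinuousLinearMap.comp_apply,
    ContinuousLinearMap.comp_apply] at he hh
  rw [hn1, ha1, map_smul, adjointCLM_expCurve_sub_e ht] at he
  have h1 : (Real.exp (2 * s) * Real.cos k ^ 2 - 1) • e +
      (-(Real.exp (2 * s) * Real.sin k ^ 2)) • f +
      (-(Real.exp (2 * s) * (Real.cos k * Real.sin k))) • h = 0 := by
    rw [← sub_eq_zero] at he
    rw [← he]
    module
  obtain ⟨h2, h3, -⟩ := IsSl2Triple.coord_eq_zero (L := GroupLieAlgebra 𝓘(ℝ, E) G) ht h1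
  have hsin : Real.sin k = 0 := by
    have h4 := Real.exp_ne_zero (2 * s)
    simpa [h4] using h3
  have hcos : Real.cos k ^ 2 = 1 := by
    have h4 := Real.sin_sq_add_cos_sq k
    rw [hsin] at h4
    simpa using h4
  have hs : s = 0 := by
    rw [hcos, mul_one, sub_eq_zero, Real.exp_eq_one_iff] at h2
    simpa using h2
  rw [hn2, hs, expCurve_zero, adjointCLM_one, one_apply_eq_self, map_add, map_smul,
    adjointCLM_expCurve_sub_e ht, adjointCLM_expCurve_sub_h ht, hsin, hcos] at hh
  have h5 : (-(2 * u)) • e + (0 : ℝ) • f + (0 : ℝ) • h = 0 := by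
    rw [← sub_eq_zero] at hh
    rw [← hh]
    module
  obtain ⟨h6, -, -⟩ := IsSl2Triple.coord_eq_zero (L := GroupLieAlgebra 𝓘(ℝ, E) G) ht h5
  have hu : u = 0 := by simpa using h6
  rw [hs, hu, expCurve_zero, expCurve_zero, mul_one, mul_one]

end Iwasawa

/-! ### The center of the subgroup of an `sl₂`-triple -/

section Center

variable {E : Type*} [NormedAddCommGroup E] [NormedSpace ℝ E] [CompleteSpace E]
  {G : Type*} [TopologicalSpace G] [ChartedSpace E G] [Group G] [LieGroup 𝓘(ℝ, E) ∞ G]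
  [T2Space G]

theorem expCurve_mem_expSubgroup {S : Submodule ℝ (GroupLieAlgebra 𝓘(ℝ, E) G)} {X : E}
    (hX : X ∈ S) (t : ℝ) : expCurve G X t ∈ expSubgroup (S : Set (GroupLieAlgebra 𝓘(ℝ, E) G)) := by
  refine Subgroup.subset_closure ⟨t • X, S.smul_mem t hX, isExp_iff.2 ?_⟩
  rw [expCurve_smul, mul_one]

/-- A central element of the connected subgroup of an `sl₂`-triple lies in its factor `K`, because
`Ad` of a central element is trivial on the triple. -/
theorem exists_eq_expCurve_of_commute [FiniteDimensional ℝ E] {h e f : E}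
    (ht : IsSl2Triple (L := GroupLieAlgebra 𝓘(ℝ, E) G) h e f)
    {S : Submodule ℝ (GroupLieAlgebra 𝓘(ℝ, E) G)} (he : e ∈ S) (hh : h ∈ S)
    (hS : ∀ X ∈ S, ∃ q r p : ℝ, X = (q • e + r • f + p • h : E)) {z : G}
    (hz : z ∈ expSubgroup (S : Set (GroupLieAlgebra 𝓘(ℝ, E) G)))
    (hc : ∀ y ∈ expSubgroup (S : Set (GroupLieAlgebra 𝓘(ℝ, E) G)), z * y = y * z) :
    (∃ k, z = expCurve G (f - e) k) ∧ adjointCLM z h = h := by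
  have hAd : ∀ X : E, X ∈ S → adjointCLM z X = X := fun X hX =>
    adjointCLM_eq_self_of_commute fun t => hc _ (expCurve_mem_expSubgroup hX t)
  obtain ⟨k, s, u, rfl⟩ := exists_iwasawa ht hS hz
  exact ⟨⟨k, iwasawa_eq_of_adjointCLM_eq ht (hAd e he) (hAd h hh)⟩, hAd h hh⟩

/-- `Ad` of the one-parameter group of `X` fixes the centralizer of `X`. -/
theorem adjointCLM_expCurve_of_lie_eq_zero [FiniteDimensional ℝ E] {X Z : E}
    (h : modelBracket G X Z = 0) (t : ℝ) : adjointCLM (expCurve G X t) Z = Z :=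
  adjointCLM_expCurve_eq (c := fun _ => Z) (fun t => by rw [h]; exact hasDerivAt_const t Z) t

end Center

end

/-! ### The center of `G(α)` -/

theorem mainTheorem11
    {E : Type*} [NormedAddCommGroup E] [NormedSpace ℝ E] [FiniteDimensional ℝ E] [CompleteSpace E]
    {G : Type*} [TopologicalSpace G] [T2Space G] [ChartedSpace E G] [Group G]
    [LieGroup 𝓘(ℝ, E) ∞ G] [ConnectedSpace G] [Finite (Subgroup.center G)]
    (hsplit : IsSplitRealFormOfSimple (GroupLieAlgebra 𝓘(ℝ, E) G))
    (θ : GroupLieAlgebra 𝓘(ℝ, E) G ≃ₗ⁅ℝ⁆ GroupLieAlgebra 𝓘(ℝ, E) G)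
    (hθ : IsCartanInvolution θ)
    (𝔞 : LieSubalgebra ℝ (GroupLieAlgebra 𝓘(ℝ, E) G))
    (h𝔞 : IsMaximalAbelianIn (noncompactPart θ) 𝔞)
    (α : Module.Dual ℝ 𝔞) (hα : IsRootOf 𝔞 α) :
    Nonempty (rootSubalgebra 𝔞 α ≃ₗ⁅ℝ⁆ LieAlgebra.SpecialLinear.sl (Fin 2) ℝ) ∧
    ∀ z : rootSubgroup 𝔞 α, z ∈ Subgroup.center (rootSubgroup 𝔞 α) →
      (z : G) ∈ centralizerInK θ 𝔞 := by
  have : FiniteDimensional ℝ (GroupLieAlgebra 𝓘(ℝ, E) G) := inferInstanceAs (FiniteDimensional ℝ E)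
  have hc : ∀ X, (∀ H ∈ 𝔞, ⁅H, X⁆ = 0) → X ∈ 𝔞 := fun X hX =>
    hsplit.mem_of_forall_lie_eq_zero hθ h𝔞 hX
  have h𝔞s : (𝔞 : Set _) ⊆ noncompactPart θ := h𝔞.1.1
  obtain ⟨h, e, t, ⟨hh, hα2⟩, he, he', hf'⟩ := exists_isSl2Triple hθ h𝔞s hc hα
  have hf : -θ e ∈ rootSpaceOf 𝔞 (-α) := by
    simpa using smul_mem_rootSpaceOf (map_mem_rootSpaceOf_neg hθ h𝔞s he) (-1)
  have hS := rootSubalgebra_eq_lieSpan he hf he' hf'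
  refine ⟨?_, fun z hz => ?_⟩
  · rw [hS, ← t.range_sl2Hom]
    exact ⟨(LieEquiv.ofInjective t.sl2Hom t.sl2Hom_injective).symm⟩
  have heS : e ∈ (rootSubalgebra 𝔞 α).toSubmodule :=
    LieSubalgebra.subset_lieSpan (Or.inl he)
  have hfS : -θ e ∈ (rootSubalgebra 𝔞 α).toSubmodule :=
    LieSubalgebra.subset_lieSpan (Or.inr hf)
  have hhS : h ∈ (rootSubalgebra 𝔞 α).toSubmodule := by
    rw [← t.lie_e_f]
    exact LieSubalgebra.lie_mem _ heS hfS
  obtain ⟨⟨k, hk⟩, hzh⟩ := exists_eq_expCurve_of_commute (E := E) (G := G) t heS hhS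
    (fun X hX => by
      obtain ⟨M, rfl⟩ := t.mem_lieSpan_iff.1 (hS ▸ hX : X ∈ LieSubalgebra.lieSpan ℝ _ {e, -θ e})
      exact ⟨_, _, _, sl2Map_apply M⟩)
    z.2 fun y hy => congrArg Subtype.val (Subgroup.mem_center_iff.1 hz ⟨y, hy⟩).symm
  refine ⟨?_, fun H hH => ?_⟩
  · have h1 : -θ e - e ∈ compactPart θ := by
      change θ _ = _
      rw [map_sub, map_neg, hθ.involutive]
      abel
    have h2 : k • (-θ e - e) ∈ compactPart θ := by
      change θ _ = _
      rw [map_smul, h1]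
    refine Subgroup.subset_closure ⟨_, h2, isExp_iff.2 ?_⟩
    rw [hk]
    have h3 := expCurve_smul (E := E) (G := G) (-θ e - e) k 1
    rw [mul_one] at h3
    exact h3.symm
  · -- The component of `H` in `ker α` commutes with the triple, and `Ad z` fixes `h`.
    set c := α ⟨H, hH⟩ / 2 with hcdef
    have hH' : H - c • h ∈ 𝔞 := sub_mem hH (𝔞.smul_mem c hh)
    have hα0 : α ⟨H - c • h, hH'⟩ = 0 := by
      have h1 : (⟨H - c • h, hH'⟩ : 𝔞) = ⟨H, hH⟩ - c • ⟨h, hh⟩ := rfl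
      rw [h1, map_sub, map_smul, hα2, hcdef, smul_eq_mul]
      ring
    have h2 : ⁅-θ e - e, H - c • h⁆ = 0 := by
      rw [← lie_skew, lie_sub, lie_of_mem_rootSpaceOf he hH', lie_of_mem_rootSpaceOf hf hH']
      simp [hα0]
    have h3 : adjointCLM (E := E) (z : G) (H - c • h) = H - c • h := by
      rw [hk]
      exact adjointCLM_expCurve_of_lie_eq_zero (E := E) (G := G) h2 k
    have h4 : ∀ (A : E →L[ℝ] E) (x y : E), A (x - c • y) = x - c • y → A y = y → A x = x := by
      intro A x y hxy hy
      rwa [map_sub, map_smul, hy, sub_left_inj] at hxy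
    exact h4 (adjointCLM (z : G)) H h h3 hzh
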